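/- Let $\mathfrak g$ be a finite-dimensional real Lie algebra and let $M$ be a connected smooth (Hausdorff, finite-dimensional) manifold. Let $\zeta:\mathfrak g\to\mathfrak X(M)$ be a homomorphism of Lie algebras into the smooth vector fields on $M$ which is transitive, i.e. $\zeta_x:\mathfrak g\to T_xM$, $X\mapsto\zeta_X(x)$, is surjective for every $x\in M$; so $M$ is a homogeneous $\mathfrak g$-space. A *principal connection* is a vector bundle homomorphism $\Phi:TM\to TM$ such that, for every $x\in M$, $\Phi_x$ is a projection onto $\zeta_x(\mathfrak g)$, and $\mathcal L_{\zeta_X}\Phi=0$ for all $X\in\mathfrak g$. A *principal connection form* is a 1-form $\omega\in\Omega^1(M;\mathfrak g)$ such that $\mathcal L_{\zeta_X}\omega=-\operatorname{ad}(X)\circ\omega$ for all $X\in\mathfrak g$ and $\zeta_x\circ\omega_x\circ\zeta_x=\zeta_x$ for all $x\in M$. Write $\mathfrak g_x=\ker\zeta_x$ for the isotropy subalgebra. Let $\Gamma(\mathfrak g)$ be the pseudogroup of all diffeomorphisms between connected open subsets of $M$ which are restrictions of finite compositions of local flows of the fields $\zeta_X$, and let $\Gamma(\mathfrak g)_x$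 be the group of germs at $x$ of elements of $\Gamma(\mathfrak g)$ which fix $x$. **Proposition 5.7.** 1. There exists a unique principal connection on $M$, namely $\Phi=\mathrm{Id}_{TM}$. 2. Suppose in addition that the action is effective, i.e. $\zeta$ is injective, and let $x\in M$. Then for each $\gamma\in\Gamma(\mathfrak g)_x$ there is a unique Lie algebra automorphism $\operatorname{Ad}(\gamma)$ of $\mathfrak g$ with $\gamma^*\zeta_X=\zeta_{\operatorname{Ad}(\gamma)^{-1}X}$ near $x$ for all $X\in\mathfrak g$. The map $\omega\mapsto\mathfrak m_x:=\omega_x(T_xM)$ is a bijection from the set of principal connection forms on $M$ onto the set of linear subspaces $\mathfrak m_x\subseteq\mathfrak g$ with $\mathfrak g=\mathfrak g_x\oplus\mathfrak m_x$ that are invariant under $\operatorname{Ad}(\gamma)$ for all $\gamma\in\Gamma(\mathfrak g)_x$. -/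

import Mathlib

open scoped Manifold ContDiff Topology

noncomputable section

/-- An action of a real Lie algebra `𝔤` on a smooth manifold `M` (modelled on `E`, without
boundary): a Lie algebra homomorphism `ζ` from `𝔤` into the smooth vector fields on `M` with the
usual bracket of vector fields. -/
structure LieAlgAction (𝔤 : Type*) [LieRing 𝔤] [LieAlgebra ℝ 𝔤]
    (E : Type*) [NormedAddCommGroup E] [NormedSpace ℝ E]
    (M : Type*) [TopologicalSpace M] [ChartedSpace E M] [IsManifold 𝓘(ℝ, E) ∞ M] where
  /-- The fundamental vector field mapping `X ↦ ζ_X`. -/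
  field : 𝔤 →ₗ[ℝ] (∀ x : M, TangentSpace 𝓘(ℝ, E) x)
  smooth : ∀ X : 𝔤, ContMDiff 𝓘(ℝ, E) 𝓘(ℝ, E).tangent ∞
    (fun x => (⟨x, field X x⟩ : TangentBundle 𝓘(ℝ, E) M))
  map_lie : ∀ X Y : 𝔤,
    field ⁅X, Y⁆ = VectorField.mlieBracket 𝓘(ℝ, E) (field X) (field Y)

/-- `η` is a smooth vector field on `M`. -/
def IsSmoothField {E : Type*} [NormedAddCommGroup E] [NormedSpace ℝ E]
    {M : Type*} [TopologicalSpace M] [ChartedSpace E M] [IsManifold 𝓘(ℝ, E) ∞ M]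
    (η : ∀ x : M, TangentSpace 𝓘(ℝ, E) x) : Prop :=
  ContMDiff 𝓘(ℝ, E) 𝓘(ℝ, E).tangent ∞ (fun x => (⟨x, η x⟩ : TangentBundle 𝓘(ℝ, E) M))

/-- The value at `x` of `(L_ξ α)(η) = ξ(α(η)) - α([ξ, η])`, the Lie derivative along the vector
field `ξ` of the real valued 1-form `α`, evaluated on the vector field `η`. -/
def lieDerivOneForm {E : Type*} [NormedAddCommGroup E] [NormedSpace ℝ E]
    {M : Type*} [TopologicalSpace M] [ChartedSpace E M] [IsManifold 𝓘(ℝ, E) ∞ M]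
    (ξ : ∀ x : M, TangentSpace 𝓘(ℝ, E) x) (α : ∀ x : M, TangentSpace 𝓘(ℝ, E) x →ₗ[ℝ] ℝ)
    (η : ∀ x : M, TangentSpace 𝓘(ℝ, E) x) (x : M) : ℝ :=
  (show ℝ from mfderiv 𝓘(ℝ, E) 𝓘(ℝ, ℝ) (fun y => α y (η y)) x (ξ x))
    - α x (VectorField.mlieBracket 𝓘(ℝ, E) ξ η x)

/-- The value at `x` of `(L_ξ Φ)(η) = [ξ, Φ(η)] - Φ([ξ, η])`, the Lie derivative along the vector
field `ξ` of the field `Φ` of endomorphisms of `TM`, evaluated on the vector field `η`. This is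
the Frölicher-Nijenhuis bracket of `ξ` and `Φ`. -/
def lieDerivEndo {E : Type*} [NormedAddCommGroup E] [NormedSpace ℝ E]
    {M : Type*} [TopologicalSpace M] [ChartedSpace E M] [IsManifold 𝓘(ℝ, E) ∞ M]
    (ξ : ∀ x : M, TangentSpace 𝓘(ℝ, E) x)
    (Φ : ∀ x : M, TangentSpace 𝓘(ℝ, E) x →ₗ[ℝ] TangentSpace 𝓘(ℝ, E) x)
    (η : ∀ x : M, TangentSpace 𝓘(ℝ, E) x) (x : M) : TangentSpace 𝓘(ℝ, E) x :=
  VectorField.mlieBracket 𝓘(ℝ, E) ξ (fun y => Φ y (η y)) x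
    - Φ x (VectorField.mlieBracket 𝓘(ℝ, E) ξ η x)

namespace LieAlgAction

variable {𝔤 : Type*} [LieRing 𝔤] [LieAlgebra ℝ 𝔤]
  {E : Type*} [NormedAddCommGroup E] [NormedSpace ℝ E]
  {M : Type*} [TopologicalSpace M] [ChartedSpace E M] [IsManifold 𝓘(ℝ, E) ∞ M]

/-- The linear map `ζ_x : 𝔤 → T_x M`, `X ↦ ζ_X(x)`. -/
def evalAt (ζ : LieAlgAction 𝔤 E M) (x : M) : 𝔤 →ₗ[ℝ] TangentSpace 𝓘(ℝ, E) x :=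
  (LinearMap.proj x).comp ζ.field

/-- The isotropy algebra `𝔤_x = ker ζ_x`. -/
def isotropyAlgebra (ζ : LieAlgAction 𝔤 E M) (x : M) : Submodule ℝ 𝔤 :=
  LinearMap.ker (ζ.evalAt x)

/-- The vertical space `𝔤(x) = {ζ_X(x) : X ∈ 𝔤}`. -/
def vertical (ζ : LieAlgAction 𝔤 E M) (x : M) : Submodule ℝ (TangentSpace 𝓘(ℝ, E) x) :=
  LinearMap.range (ζ.evalAt x)

/-- The action is effective. -/
def IsEffective (ζ : LieAlgAction 𝔤 E M) : Prop :=
  Function.Injective ζ.field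

/-- The action is transitive. -/
def IsTransitive (ζ : LieAlgAction 𝔤 E M) : Prop :=
  ∀ x : M, Function.Surjective (ζ.evalAt x)

/-- `M` is a homogeneous `𝔤`-space: it is connected and the action is transitive. -/
def IsHomogeneous (ζ : LieAlgAction 𝔤 E M) : Prop :=
  ConnectedSpace M ∧ ζ.IsTransitive

/-- `Φ` is a principal connection: a vector bundle homomorphism `TM → TM` which at each point is
a projection onto the vertical space, and whose Lie derivatives along all fundamental vector
fields vanish. -/
structure IsPrincipalConnection (ζ : LieAlgAction 𝔤 E M)
    (Φ : ∀ x : M, TangentSpace 𝓘(ℝ, E) x →ₗ[ℝ] TangentSpace 𝓘(ℝ, E) x) : Prop where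
  smooth : ContMDiff 𝓘(ℝ, E).tangent 𝓘(ℝ, E).tangent ∞
    (fun v : TangentBundle 𝓘(ℝ, E) M => (⟨v.proj, Φ v.proj v.2⟩ : TangentBundle 𝓘(ℝ, E) M))
  isProj : ∀ x : M, LinearMap.IsProj (ζ.vertical x) (Φ x)
  equivariant : ∀ X : 𝔤, ∀ η : (∀ x : M, TangentSpace 𝓘(ℝ, E) x), IsSmoothField η →
    ∀ x : M, lieDerivEndo (ζ.field X) Φ η x = 0

/-- `θ` is a principal connection form: a smooth `𝔤`-valued 1-form with
`L_{ζ_X} θ = - ad(X) ∘ θ` for all `X` and `ζ_x ∘ θ_x ∘ ζ_x = ζ_x` for all `x`. Smoothness and the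
Lie derivative of `𝔤`-valued forms are tested on the linear functionals of the finite dimensional
vector space `𝔤`. -/
structure IsPrincipalConnectionForm (ζ : LieAlgAction 𝔤 E M)
    (θ : ∀ x : M, TangentSpace 𝓘(ℝ, E) x →ₗ[ℝ] 𝔤) : Prop where
  smooth : ∀ f : Module.Dual ℝ 𝔤, ContMDiff 𝓘(ℝ, E).tangent 𝓘(ℝ, ℝ) ∞
    (fun v : TangentBundle 𝓘(ℝ, E) M => f (θ v.proj v.2))
  equivariant : ∀ X : 𝔤, ∀ f : Module.Dual ℝ 𝔤,
    ∀ η : (∀ x : M, TangentSpace 𝓘(ℝ, E) x), IsSmoothField η →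
      ∀ x : M, lieDerivOneForm (ζ.field X) (fun y => f ∘ₗ θ y) η x = f (-⁅X, θ x (η x)⁆)
  reproduces : ∀ x : M, ζ.evalAt x ∘ₗ θ x ∘ₗ ζ.evalAt x = ζ.evalAt x

/-- The local flow of `ζ_X` is defined at `y` at time `t`, and maps `y` to `z`. -/
def FlowsTo (ζ : LieAlgAction 𝔤 E M) (X : 𝔤) (t : ℝ) (y z : M) : Prop :=
  ∃ c : ℝ → M, IsMIntegralCurveOn (I := 𝓘(ℝ, E)) c (ζ.field X) (Set.uIcc 0 t) ∧
    c 0 = y ∧ c t = z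

/-- For a list `[(X₁, t₁), …, (Xₙ, tₙ)]`, the composition of the local flows of `ζ_{X₁}` at time
`t₁`, then `ζ_{X₂}` at time `t₂`, and so on, is defined at `y` and maps `y` to `z`. -/
def FlowsToList (ζ : LieAlgAction 𝔤 E M) : List (𝔤 × ℝ) → M → M → Prop
  | [], y, z => y = z
  | p :: L, y, z => ∃ w : M, ζ.FlowsTo p.1 p.2 y w ∧ ζ.FlowsToList L w z

/-- The pseudogroup `Γ(𝔤)`: diffeomorphisms between connected open subsets of `M` that are
restrictions of compositions of local flows of fundamental vector fields. -/
def pseudogroup (ζ : LieAlgAction 𝔤 E M) : Set (OpenPartialHomeomorph M M) :=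
  {φ | IsConnected φ.source ∧
    ContMDiffOn 𝓘(ℝ, E) 𝓘(ℝ, E) ∞ φ φ.source ∧
    ContMDiffOn 𝓘(ℝ, E) 𝓘(ℝ, E) ∞ φ.symm φ.target ∧
    ∃ L : List (𝔤 × ℝ), ∀ y ∈ φ.source, ζ.FlowsToList L y (φ y)}

/-- The elements of the isotropy group `Γ(𝔤)_x`: the germs at `x` of the elements of the
pseudogroup that fix `x`. -/
def isotropyGroup (ζ : LieAlgAction 𝔤 E M) (x : M) : Set ((𝓝 x).Germ M) :=
  {γ | ∃ φ ∈ ζ.pseudogroup, x ∈ φ.source ∧ φ x = x ∧ γ = ((φ : M → M) : (𝓝 x).Germ M)}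

/-- `A = Ad(γ)` for a germ `γ` at `x` of a local diffeomorphism: `A` is an automorphism of `𝔤`
with `γ^* ζ_X = ζ_{A⁻¹ X}` near `x` for all `X`. -/
def IsAdjoint (ζ : LieAlgAction 𝔤 E M) (x : M) (γ : (𝓝 x).Germ M) (A : 𝔤 ≃ₗ⁅ℝ⁆ 𝔤) : Prop :=
  ∃ φ : M → M, γ = (φ : (𝓝 x).Germ M) ∧ ∀ X : 𝔤, ∀ᶠ y in 𝓝 x,
    VectorField.mpullback 𝓘(ℝ, E) 𝓘(ℝ, E) φ (ζ.field X) y = ζ.field (A.symm X) y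

/-- The subspace `𝔪` of `𝔤` is invariant under `Ad(γ)` for all `γ` in `Γ(𝔤)_x`. -/
def IsIsotropyInvariant (ζ : LieAlgAction 𝔤 E M) (x : M) (𝔪 : Submodule ℝ 𝔤) : Prop :=
  ∀ γ ∈ ζ.isotropyGroup x, ∀ A : 𝔤 ≃ₗ⁅ℝ⁆ 𝔤, ζ.IsAdjoint x γ A → ∀ Y ∈ 𝔪, A Y ∈ 𝔪

end LieAlgAction

end

/-! Part 1 is pointwise: by transitivity the vertical space is the whole tangent space, the only
projection onto it is the identity, and the identity has zero Lie derivative.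

Part 2 rests on one formula. If `φ` is the time one flow of `ζ_X`, then `Tφ ∘ ζ_Y = ζ_{exp(-ad X) Y}
∘ φ`. A composition of flows therefore acts on `𝔤` by a product of exponentials of derivations. This
is an automorphism, and it is `Ad` of the germ. `Ad` is unique because a field `ζ_X` that vanishes
near one point vanishes everywhere: the space of such `X` can only grow as the point moves slightly,
while flows, which join any two points of the connected `M`, keep its dimension constant
(`eq_of_eventually_family_eq`).

A connection form `ω` is encoded by `P_x = ω_x ∘ ζ_x`, the projection of `𝔤` onto `𝔪_x` along `𝔤_x`.
Its equivariance is the linear equation `P' = P ad(X) - ad(X) P` along integral curves of `ζ_X`,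
which integrates to `P_y exp(-ad X) = exp(-ad X) P_x`. Along loops this gives the invariance of
`𝔪_x`; along paths from `x` it gives injectivity. Conversely, the projection onto an invariant
complement is carried from `x` to all of `M` by flows (`exists_isTransportEquivariant`). The result
does not depend on the path because the projection commutes with `Ad`, and it is smooth because
nearby points are reached by the flow of a field depending smoothly on the point
(`exists_connectionForm`).

The analytic input is `exists_local_flow`. Closure under brackets solves the linearized flow
equation explicitly, so the derivative of the flow is a smooth function of the starting data and the
end point; smoothness of the flow follows by bootstrapping. -/

set_option linter.unusedSectionVars false

noncomputable section

/-! ### Differentiability of the time one map of an ordinary differential equation. -/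

section LinearizedFlow

open Set Metric

variable {P : Type*} [NormedAddCommGroup P] [NormedSpace ℝ P]

lemma gronwallBound_zero_mul (K ε c t : ℝ) :
    gronwallBound 0 K (c * ε) t = c * gronwallBound 0 K ε t := by
  unfold gronwallBound
  split_ifs <;> ring

/-- An exact solution `y` stays quadratically close to the first order approximation `x + w`, where
`w` solves the equation linearized along the solution `x`. -/
lemma norm_sub_linearized_solution_le {g : P → P} {g' : P → P →L[ℝ] P} {B : Set P} {K : NNReal}
    {L m : ℝ} (hL : 0 ≤ L) (hlip : LipschitzOnWith K g B)
    (hquad : ∀ x ∈ B, ∀ y ∈ B, ‖g y - g x - g' x (y - x)‖ ≤ L * ‖y - x‖ ^ 2)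
    {x y w : ℝ → P}
    (hx : ∀ t ∈ Icc (0 : ℝ) 1, HasDerivWithinAt x (g (x t)) (Icc 0 1) t)
    (hy : ∀ t ∈ Icc (0 : ℝ) 1, HasDerivWithinAt y (g (y t)) (Icc 0 1) t)
    (hw : ∀ t ∈ Icc (0 : ℝ) 1, HasDerivWithinAt w (g' (x t) (w t)) (Icc 0 1) t)
    (hxB : ∀ t ∈ Icc (0 : ℝ) 1, x t ∈ B) (hyB : ∀ t ∈ Icc (0 : ℝ) 1, y t ∈ B)
    (hwB : ∀ t ∈ Icc (0 : ℝ) 1, x t + w t ∈ B) (hm : ∀ t ∈ Icc (0 : ℝ) 1, ‖w t‖ ≤ m)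
    (h0 : y 0 = x 0 + w 0) :
    ‖y 1 - (x 1 + w 1)‖ ≤ m ^ 2 * gronwallBound 0 K L 1 := by
  have hIci {u : ℝ → P} {u' : P} {t : ℝ} (ht : t ∈ Ico (0 : ℝ) 1)
      (h : HasDerivWithinAt u u' (Icc 0 1) t) : HasDerivWithinAt u u' (Ici t) t :=
    (h.mono (Icc_subset_Icc_left ht.1)).mono_of_mem_nhdsWithin (Icc_mem_nhdsGE ht.2)
  have hc {u : ℝ → P} {u' : ℝ → P} (h : ∀ t ∈ Icc (0 : ℝ) 1, HasDerivWithinAt u (u' t) (Icc 0 1) t) :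
      ContinuousOn u (Icc 0 1) := fun t ht => (h t ht).continuousWithinAt
  have hxw : ∀ t ∈ Icc (0 : ℝ) 1,
      HasDerivWithinAt (fun t => x t + w t) (g (x t) + g' (x t) (w t)) (Icc 0 1) t :=
    fun t ht => (hx t ht).add (hw t ht)
  -- `x + w` solves the equation up to the second order remainder of `g`, at most `L * m ^ 2`, and
  -- starts where `y` starts. Gronwall's inequality turns this defect into the bound.
  have key := dist_le_of_approx_trajectories_ODE_of_mem (v := fun _ => g) (s := fun _ => B)
    (K := K) (f := y) (g := fun t => x t + w t) (f' := fun t => g (y t))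
    (g' := fun t => g (x t) + g' (x t) (w t)) (a := 0) (b := 1) (εf := 0) (εg := m ^ 2 * L) (δ := 0)
    (fun _ _ => hlip) (hc hy) (fun t ht => hIci ht (hy t (Ico_subset_Icc_self ht)))
    (fun t _ => by simp) (fun t ht => hyB t (Ico_subset_Icc_self ht)) (hc hxw)
    (fun t ht => hIci ht (hxw t (Ico_subset_Icc_self ht)))
    (fun t ht => by
      have ht' := Ico_subset_Icc_self ht
      have h1 := hquad (x t) (hxB t ht') (x t + w t) (hwB t ht')
      rw [add_sub_cancel_left] at h1
      rw [dist_comm, dist_eq_norm]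
      calc _ = ‖g (x t + w t) - g (x t) - g' (x t) (w t)‖ := by congr 1; abel
        _ ≤ L * ‖w t‖ ^ 2 := h1
        _ ≤ L * m ^ 2 := by gcongr; exact hm t ht'
        _ = m ^ 2 * L := mul_comm _ _)
    (fun t ht => hwB t (Ico_subset_Icc_self ht)) (by simp [h0]) 1 (by simp)
  rw [dist_eq_norm] at key
  simpa [gronwallBound_zero_mul] using key

/-- Linear equations with bounded coefficients have unique solutions. -/
lemma eq_zero_of_linear_ODE {A : ℝ → P →L[ℝ] P} {C : ℝ} {u : ℝ → P}
    (hu : ∀ t ∈ Icc (0 : ℝ) 1, HasDerivWithinAt u (A t (u t)) (Icc 0 1) t)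
    (hA : ∀ t ∈ Icc (0 : ℝ) 1, ‖A t‖ ≤ C) (h0 : u 0 = 0) : u 1 = 0 := by
  refine eq_zero_of_abs_deriv_le_mul_abs_self_of_eq_zero_right (K := C) (a := 0) (b := 1)
    (f' := fun t => A t (u t)) (fun t ht => (hu t ht).continuousWithinAt)
    (fun t ht => ?_) h0 (fun t ht => ?_) 1 (by simp)
  · exact ((hu t (Ico_subset_Icc_self ht)).mono (Icc_subset_Icc_left ht.1)).mono_of_mem_nhdsWithin
      (Icc_mem_nhdsGE ht.2)
  · exact (A t).le_of_opNorm_le (hA t (Ico_subset_Icc_self ht)) _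

/-- A `C^2` function is locally Lipschitz and approximated to second order by its derivative. -/
lemma ContDiffAt.exists_quadratic_bound {Q : Type*} [NormedAddCommGroup Q] [NormedSpace ℝ Q]
    {g : P → Q} {p : P} (hg : ContDiffAt ℝ 2 g p) :
    ∃ (K : NNReal) (L r : ℝ), 0 ≤ L ∧ 0 < r ∧ LipschitzOnWith K g (closedBall p r) ∧
      (∀ x ∈ closedBall p r, ‖fderiv ℝ g x‖ ≤ L) ∧
      (∀ x ∈ closedBall p r, DifferentiableAt ℝ g x) ∧
      ∀ x ∈ closedBall p r, ∀ y ∈ closedBall p r,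
        ‖g y - g x - fderiv ℝ g x (y - x)‖ ≤ L * ‖y - x‖ ^ 2 := by
  obtain ⟨K, s, hs, hK⟩ := (hg.of_le one_le_two).exists_lipschitzOnWith
  have hg1 : ContDiffAt ℝ 1 (fderiv ℝ g) p := hg.fderiv_right (by norm_num)
  obtain ⟨K', s', hs', hK'⟩ := hg1.exists_lipschitzOnWith
  have hd : ∀ᶠ x in 𝓝 p, DifferentiableAt ℝ g x :=
    (hg.eventually (by simp)).mono fun x hx => hx.differentiableAt (by simp)
  have hb : ∀ᶠ x in 𝓝 p, ‖fderiv ℝ g x‖ ≤ ‖fderiv ℝ g p‖ + 1 :=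
    (hg1.continuousAt.norm.eventually (gt_mem_nhds (lt_add_one _))).mono fun x hx => le_of_lt hx
  obtain ⟨r, hr, hrs⟩ := nhds_basis_closedBall.mem_iff.1
    (Filter.inter_mem (Filter.inter_mem hs hs') (hd.and hb))
  refine ⟨K, max K' (‖fderiv ℝ g p‖ + 1), r, by positivity, hr, hK.mono fun x hx => (hrs hx).1.1,
    fun x hx => (hrs hx).2.2.trans (le_max_right _ _), fun x hx => (hrs hx).2.1,
    fun x hx y hy => ?_⟩
  have hseg : segment ℝ x y ⊆ closedBall p r := (convex_closedBall p r).segment_subset hx hy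
  -- Mean value inequality for `g` minus its linear part at `x`: along the segment the derivative
  -- moves by at most `K' * ‖y - x‖`.
  have := (convex_segment x y).norm_image_sub_le_of_norm_hasFDerivWithin_le' (𝕜 := ℝ) (f := g)
    (f' := fderiv ℝ g) (φ := fderiv ℝ g x) (C := K' * ‖y - x‖)
    (fun z hz => (hrs (hseg hz)).2.1.hasFDerivAt.hasFDerivWithinAt) (fun z hz => by
      have h1 := hK'.dist_le_mul z (hrs (hseg hz)).1.2 x (hrs hx).1.2
      rw [dist_eq_norm, dist_eq_norm] at h1
      refine h1.trans ?_
      gcongr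
      obtain ⟨t, ht, rfl⟩ := (segment_eq_image' ℝ x y).subset hz
      rw [add_sub_cancel_left, norm_smul, Real.norm_of_nonneg ht.1]
      exact mul_le_of_le_one_left (norm_nonneg _) ht.2)
    (left_mem_segment ℝ x y) (right_mem_segment ℝ x y)
  calc _ ≤ K' * ‖y - x‖ * ‖y - x‖ := this
    _ = K' * ‖y - x‖ ^ 2 := by ring
    _ ≤ _ := by gcongr; exact le_max_left _ _

/-- If `F p` is the value at time `1` of a solution starting at `p`, then `F` is differentiable and
its derivative is the value at time `1` of the solution operator of the linearized equation. -/
lemma hasFDerivAt_time_one {g : P → P} {B : Set P} {K : NNReal} {L C r : ℝ} (hL : 0 ≤ L)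
    (hlip : LipschitzOnWith K g B)
    (hquad : ∀ x ∈ B, ∀ y ∈ B, ‖g y - g x - fderiv ℝ g x (y - x)‖ ≤ L * ‖y - x‖ ^ 2)
    {γ : P → ℝ → P} {p : P} (hr : 0 < r)
    (hγ : ∀ᶠ q in 𝓝 p, γ q 0 = q ∧ ∀ t ∈ Icc (0 : ℝ) 1,
      HasDerivWithinAt (γ q) (g (γ q t)) (Icc 0 1) t ∧ γ q t ∈ B)
    (hpB : ∀ t ∈ Icc (0 : ℝ) 1, ball (γ p t) r ⊆ B)
    {D : ℝ → P →L[ℝ] P} (hD0 : D 0 = ContinuousLinearMap.id ℝ P)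
    (hD : ∀ v, ∀ t ∈ Icc (0 : ℝ) 1,
      HasDerivWithinAt (fun t => D t v) (fderiv ℝ g (γ p t) (D t v)) (Icc 0 1) t)
    (hC : ∀ t ∈ Icc (0 : ℝ) 1, ‖D t‖ ≤ C) :
    HasFDerivAt (fun q => γ q 1) (D 1) p := by
  have hC0 : 0 ≤ C := (norm_nonneg _).trans (hC 0 (by simp))
  have hp := hγ.self_of_nhds
  have hnear : ∀ᶠ q in 𝓝 p, C * ‖q - p‖ < r := by
    have : Filter.Tendsto (fun q : P => C * ‖q - p‖) (𝓝 p) (𝓝 (C * ‖p - p‖)) :=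
      (by fun_prop : Continuous fun q : P => C * ‖q - p‖).tendsto p
    exact this.eventually (gt_mem_nhds (by simpa using hr))
  -- The solution of the linearized equation starting at `q - p` is `D t (q - p)`, of size at most
  -- `C * ‖q - p‖`; the comparison lemma then leaves a quadratic error.
  have hO : (fun q => γ q 1 - γ p 1 - D 1 (q - p)) =O[𝓝 p] fun q => ‖q - p‖ ^ 2 := by
    refine Asymptotics.IsBigO.of_bound (C ^ 2 * gronwallBound 0 K L 1) ?_
    filter_upwards [hγ, hnear] with q hq hqr
    have hwn : ∀ t ∈ Icc (0 : ℝ) 1, ‖D t (q - p)‖ ≤ C * ‖q - p‖ :=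
      fun t ht => (D t).le_of_opNorm_le (hC t ht) _
    have := norm_sub_linearized_solution_le hL hlip hquad (m := C * ‖q - p‖)
      (fun t ht => (hp.2 t ht).1) (fun t ht => (hq.2 t ht).1) (hD (q - p))
      (fun t ht => (hp.2 t ht).2) (fun t ht => (hq.2 t ht).2)
      (fun t ht => hpB t ht (by
        rw [mem_ball, dist_eq_norm, add_sub_cancel_left]
        exact (hwn t ht).trans_lt hqr)) hwn (by simp [hp.1, hq.1, hD0])
    rw [norm_pow, norm_norm, sub_sub]
    exact this.trans_eq (by ring)
  refine .of_isLittleO (hO.trans_isLittleO ?_)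
  have h1 : (fun q : P => ‖q - p‖ ^ 2) =o[𝓝 p] fun q => ‖q - p‖ := by
    have h2 := (Asymptotics.isLittleO_pow_id (𝕜 := ℝ) one_lt_two).comp_tendsto
      (show Filter.Tendsto (fun q : P => ‖q - p‖) (𝓝 p) (𝓝 0) by
        simpa using (by fun_prop : Continuous fun q : P => ‖q - p‖).tendsto p)
    exact h2
  exact h1.of_norm_right

/-- A solution of a total differential equation with smooth right hand side is smooth. -/
lemma contDiffOn_of_hasFDerivAt_self {Q : Type*} [NormedAddCommGroup Q] [NormedSpace ℝ Q]
    {F : P → Q} {G : P × Q → P →L[ℝ] Q} {O : Set P} {S : Set (P × Q)} (hO : IsOpen O)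
    (hG : ContDiffOn ℝ ∞ G S) (hFS : ∀ p ∈ O, (p, F p) ∈ S)
    (hF : ∀ p ∈ O, HasFDerivAt F (G (p, F p)) p) : ContDiffOn ℝ ∞ F O := by
  rw [contDiffOn_infty]
  intro n
  induction n with
  | zero => exact contDiffOn_zero.2 fun p hp => (hF p hp).continuousAt.continuousWithinAt
  | succ n ih =>
    push_cast
    rw [contDiffOn_succ_iff_fderiv_of_isOpen hO]
    refine ⟨fun p hp => (hF p hp).differentiableAt.differentiableWithinAt, by simp, ?_⟩
    -- Bootstrapping: if `F` is `C^n`, so is its derivative `G (p, F p)`, hence `F` is `C^(n+1)`.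
    have : ContDiffOn ℝ n (fun p => G (p, F p)) O :=
      (hG.of_le (by exact_mod_cast le_top)).comp (contDiffOn_id.prodMk ih) hFS
    exact this.congr fun p hp => (hF p hp).fderiv

end LinearizedFlow

/-! ### Existence of solutions up to time one. -/

section PicardOne

open Set Metric

variable {E : Type*} [NormedAddCommGroup E] [NormedSpace ℝ E] [CompleteSpace E]

/-- Solutions on `[0, 1]` of an autonomous equation with small right hand side. -/
lemma exists_solution_mem_closedBall {f : E → E} {q₀ q : E} {a r L K : NNReal}
    (hb : ∀ x ∈ closedBall q₀ a, ‖f x‖ ≤ L) (hl : LipschitzOnWith K f (closedBall q₀ a))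
    (hm : (L : ℝ) ≤ a - r) (hq : q ∈ closedBall q₀ r) :
    ∃ c : ℝ → E, c 0 = q ∧ ∀ t ∈ Icc (0 : ℝ) 1,
      HasDerivWithinAt c (f (c t)) (Icc 0 1) t ∧ c t ∈ closedBall q₀ a := by
  have hf : IsPicardLindelof (fun _ => f) (⟨0, by simp⟩ : Icc (0 : ℝ) 1) q₀ a r L K :=
    .of_time_independent hb hl (by simpa using hm)
  obtain ⟨α, hα⟩ := ODE.FunSpace.exists_isFixedPt_next hf hq
  refine ⟨α.compProj, ?_, fun t ht => ⟨?_, α.compProj_mem_closedBall hf.mul_max_le⟩⟩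
  · have h0 : α.compProj ((⟨0, by simp⟩ : Icc (0 : ℝ) 1) : ℝ) = q := by
      rw [ODE.FunSpace.compProj_val, ← hα, ODE.FunSpace.next_apply₀]
    exact h0
  · apply (ODE.hasDerivWithinAt_picard_Icc (⟨0, by simp⟩ : Icc (0 : ℝ) 1).2 hf.continuousOn_uncurry
      α.continuous_compProj.continuousOn (fun _ _ => α.compProj_mem_closedBall hf.mul_max_le)
      q ht).congr_of_mem _ ht
    intro t' ht'
    nth_rw 1 [← hα]
    rw [ODE.FunSpace.compProj_of_mem ht', ODE.FunSpace.next_apply]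

end PicardOne

/-! ### Smooth right inverses of a family of surjections. -/

section RightInverse

variable {V E : Type*} [NormedAddCommGroup V] [NormedSpace ℝ V]
  [NormedAddCommGroup E] [NormedSpace ℝ E] [FiniteDimensional ℝ E]

/-- For a fixed right inverse `s` of `z q₀`, the endomorphism `z q ∘ s` of `E` is the identity at
`q₀`. Where it is invertible, `s ∘ (z q ∘ s)⁻¹` is a right inverse, and inversion is smooth on
units. -/
lemma exists_smooth_rightInverse {z : E → V →L[ℝ] E} {Ω : Set E} (hΩ : IsOpen Ω)
    (hz : ContDiffOn ℝ ∞ z Ω) {q₀ : E} (hq₀ : q₀ ∈ Ω) (hs : Function.Surjective (z q₀)) :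
    ∃ (U : Set E) (σ : E → E →L[ℝ] V), IsOpen U ∧ q₀ ∈ U ∧ U ⊆ Ω ∧ ContDiffOn ℝ ∞ σ U ∧
      ∀ q ∈ U, ∀ v, z q (σ q v) = v := by
  have := FiniteDimensional.complete ℝ E
  obtain ⟨s, hs⟩ := (z q₀).toLinearMap.exists_rightInverse_of_surjective
    (LinearMap.range_eq_top.2 hs)
  let s' : E →L[ℝ] V := LinearMap.toContinuousLinearMap s
  have hs' : z q₀ ∘L s' = 1 := by
    ext v
    exact LinearMap.congr_fun hs v
  have hA : ContDiffOn ℝ ∞ (fun q => z q ∘L s') Ω := hz.clm_comp contDiffOn_const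
  refine ⟨Ω ∩ (fun q => z q ∘L s') ⁻¹' {u | IsUnit u}, fun q => s' ∘L Ring.inverse (z q ∘L s'),
    hA.continuousOn.isOpen_inter_preimage hΩ Units.isOpen, ⟨hq₀, ?_⟩, Set.inter_subset_left,
    ?_, ?_⟩
  · simp [hs']
  · refine contDiffOn_const.clm_comp fun q hq => ?_
    obtain ⟨u, hu⟩ := hq.2
    have h1 : ContDiffAt ℝ ∞ Ring.inverse (z q ∘L s') := by
      have hu' : (u : E →L[ℝ] E) = z q ∘L s' := hu
      rw [← hu']
      exact contDiffAt_ringInverse ℝ u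
    exact h1.comp_contDiffWithinAt q ((hA q hq.1).mono Set.inter_subset_left)
  · rintro q ⟨-, hq⟩ v
    have := Ring.mul_inverse_cancel _ hq
    exact congrArg (fun A : E →L[ℝ] E => A v) this

end RightInverse


/-! ### Smooth local flow of a bracket-closed family of fields on a vector space. -/

section LocalFlow

open Set Metric NormedSpace

variable {V E : Type*} [NormedAddCommGroup V] [NormedSpace ℝ V]
  [NormedAddCommGroup E] [NormedSpace ℝ E]

/-- The generator `(W, Y) ↦ (Y - ad W, 0)` of the equation `W' = Y - ad W` with constant `Y`. -/
def affineGenerator (ad : V →L[ℝ] V) : (V × V) →L[ℝ] V × V :=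
  ContinuousLinearMap.inl ℝ V V ∘L
    (ContinuousLinearMap.snd ℝ V V - ad ∘L ContinuousLinearMap.fst ℝ V V)

lemma affineGenerator_apply (ad : V →L[ℝ] V) (w : V × V) :
    affineGenerator ad w = (w.2 - ad w.1, 0) := rfl

lemma hasDerivAt_exp_smul_apply {A : Type*} [NormedAddCommGroup A] [NormedSpace ℝ A]
    [CompleteSpace A] (N : A →L[ℝ] A) (w : A) (t : ℝ) :
    HasDerivAt (fun t : ℝ => exp (t • N) w) (N (exp (t • N) w)) t := by
  have h := (hasDerivAt_exp_smul_const' (𝕂 := ℝ) N t).clm_apply (hasDerivAt_const t w)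
  simpa using h

lemma snd_exp_affineGenerator [CompleteSpace V] (ad : V →L[ℝ] V) (w : V × V) (t : ℝ) :
    (exp (t • affineGenerator ad) w).2 = w.2 := by
  have hd : ∀ t, HasDerivAt (fun t : ℝ => (exp (t • affineGenerator ad) w).2) 0 t := fun t => by
    have := (ContinuousLinearMap.snd ℝ V V).hasFDerivAt.comp_hasDerivAt t
      (hasDerivAt_exp_smul_apply (affineGenerator ad) w t)
    exact this
  have := is_const_of_deriv_eq_zero (fun t => (hd t).differentiableAt) (fun t => (hd t).deriv) t 0
  simpa using this

lemma hasDerivAt_fst_exp_affineGenerator [CompleteSpace V] (ad : V →L[ℝ] V) (w : V × V) (t : ℝ) :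
    HasDerivAt (fun t : ℝ => (exp (t • affineGenerator ad) w).1)
      (w.2 - ad (exp (t • affineGenerator ad) w).1) t := by
  have := (ContinuousLinearMap.fst ℝ V V).hasFDerivAt.comp_hasDerivAt t
    (hasDerivAt_exp_smul_apply (affineGenerator ad) w t)
  rw [affineGenerator_apply, snd_exp_affineGenerator] at this
  exact this

/-- By the bracket relation, `Dz(z X) W - z (b X W)` equals `Dz(z W) X`. The ansatz `z (c t) (W t)`
thus reduces the equation linearized along `c`, with parameter variation `Y`, to the constant
coefficient equation `W' = Y - b X W`. -/
lemma hasDerivWithinAt_field_along {z : E → V →L[ℝ] E} {b : V →L[ℝ] V →L[ℝ] V} {X Y : V}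
    {c : ℝ → E} {W : ℝ → V} {s : Set ℝ} {t : ℝ} (hz : DifferentiableAt ℝ z (c t))
    (hb : ∀ X Y, fderiv ℝ z (c t) (z (c t) X) Y - fderiv ℝ z (c t) (z (c t) Y) X
      = z (c t) (b X Y))
    (hc : HasDerivWithinAt c (z (c t) X) s t) (hW : HasDerivWithinAt W (Y - b X (W t)) s t) :
    HasDerivWithinAt (fun t => z (c t) (W t))
      (fderiv ℝ z (c t) (z (c t) (W t)) X + z (c t) Y) s t := by
  have h := (hz.hasFDerivAt.comp_hasDerivWithinAt t hc).clm_apply hW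
  refine h.congr_deriv ?_
  simp only [Function.comp_apply, map_sub]
  rw [← hb X (W t)]
  abel

lemma contDiff_exp_clm {A : Type*} [NormedAddCommGroup A] [NormedSpace ℝ A] [CompleteSpace A] :
    ContDiff ℝ ∞ (exp : (A →L[ℝ] A) → A →L[ℝ] A) :=
  contDiff_iff_contDiffAt.2 fun x => (exp_analytic (𝕂 := ℝ) x).contDiffAt

/-- Surjectivity of `z` makes every initial vector a value `z q (σ q v)`, so the ansatz of
`hasDerivWithinAt_field_along` yields all solutions of the linearized equation by exponentials. The
derivative of the time one map `F` then has the form `G (p, F p)` with `G` smooth. The last clause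
of the conclusion is the infinitesimal form of the adjoint action. -/
theorem exists_local_flow [CompleteSpace V] [FiniteDimensional ℝ E] {z : E → V →L[ℝ] E} {b : V →L[ℝ] V →L[ℝ] V}
    {Ω : Set E} (hΩ : IsOpen Ω) (hz : ContDiffOn ℝ ∞ z Ω) {q₀ : E} (hq₀ : q₀ ∈ Ω)
    (hs : Function.Surjective (z q₀))
    (hb : ∀ q ∈ Ω, ∀ X Y, fderiv ℝ z q (z q X) Y - fderiv ℝ z q (z q Y) X = z q (b X Y)) :
    ∃ (O : Set (V × E)) (F : V × E → E), IsOpen O ∧ (0, q₀) ∈ O ∧ ContDiffOn ℝ ∞ F O ∧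
      F (0, q₀) = q₀ ∧ (∀ Y, fderiv ℝ F (0, q₀) (Y, 0) = z q₀ Y) ∧
      (∀ p ∈ O, ∃ c : ℝ → E, c 0 = p.2 ∧ c 1 = F p ∧ ∀ t ∈ Icc (0 : ℝ) 1,
        c t ∈ Ω ∧ HasDerivWithinAt c (z (c t) p.1) (Icc 0 1) t) ∧
      ∀ p ∈ O, ∀ Y, fderiv ℝ F p (0, z p.2 Y) = z (F p) (exp (-b p.1) Y) := by
  have := FiniteDimensional.complete ℝ E
  obtain ⟨U, σ, hUo, hqU, hUΩ, hσ, hσz⟩ := exists_smooth_rightInverse hΩ hz hq₀ hs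
  -- The parameter `X` is adjoined as a constant unknown, so that derivatives in `X` and in the
  -- initial point are treated at once.
  set g : V × E → V × E := fun p => (0, z p.2 p.1) with hg
  have hgΩ : ContDiffOn ℝ ∞ g (univ ×ˢ Ω) :=
    contDiffOn_const.prodMk ((hz.comp contDiffOn_snd fun p hp => hp.2).clm_apply contDiffOn_fst)
  have hzd : ∀ q ∈ Ω, DifferentiableAt ℝ z q := fun q hq =>
    (hz.contDiffAt (hΩ.mem_nhds hq)).differentiableAt (by simp)
  have hg' : ∀ p : V × E, p.2 ∈ Ω → ∀ v : V × E,
      fderiv ℝ g p v = (0, fderiv ℝ z p.2 v.2 p.1 + z p.2 v.1) := by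
    intro p hp v
    have h1 : HasFDerivAt (fun p : V × E => z p.2) (fderiv ℝ z p.2 ∘L .snd ℝ V E) p :=
      HasFDerivAt.comp p (hzd _ hp).hasFDerivAt hasFDerivAt_snd
    have h2 := (hasFDerivAt_const (0 : V) p).prodMk (h1.clm_apply hasFDerivAt_fst)
    rw [HasFDerivAt.fderiv h2]
    simp [add_comm]
  have hgp : ContDiffAt ℝ 2 g (0, q₀) :=
    (hgΩ.contDiffAt ((isOpen_univ.prod hΩ).mem_nhds ⟨trivial, hq₀⟩)).of_le
      ENat.LEInfty.out
  obtain ⟨K, L, r₁, hL, hr₁, hlip₁, hgL₁, -, hquad₁⟩ := ContDiffAt.exists_quadratic_bound hgp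
  have hzb : ∀ᶠ q in 𝓝 q₀, ‖z q‖ ≤ ‖z q₀‖ + 1 :=
    ((hz.continuousOn.continuousAt (hΩ.mem_nhds hq₀)).norm.eventually
      (gt_mem_nhds (lt_add_one _))).mono fun x hx => le_of_lt hx
  obtain ⟨r₂, hr₂, hrU⟩ := nhds_basis_closedBall.mem_iff.1
    (Filter.inter_mem (hUo.mem_nhds hqU) hzb)
  obtain ⟨r, hr, hrr₁, hrr₂⟩ : ∃ r : ℝ, 0 < r ∧ r ≤ r₁ ∧ r ≤ r₂ :=
    ⟨min r₁ r₂, lt_min hr₁ hr₂, min_le_left _ _, min_le_right _ _⟩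
  set B : Set (V × E) := closedBall (0, q₀) r with hB
  have hBmem : ∀ p : V × E, p ∈ B ↔ ‖p.1‖ ≤ r ∧ p.2 ∈ closedBall q₀ r := fun p => by
    rw [hB, ← closedBall_prod_same]; simp
  have hlip : LipschitzOnWith K g B := hlip₁.mono (closedBall_subset_closedBall hrr₁)
  have hquad : ∀ x ∈ B, ∀ y ∈ B, ‖g y - g x - fderiv ℝ g x (y - x)‖ ≤ L * ‖y - x‖ ^ 2 :=
    fun x hx y hy => hquad₁ x (closedBall_subset_closedBall hrr₁ hx) y
      (closedBall_subset_closedBall hrr₁ hy)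
  have hgL : ∀ x ∈ B, ‖fderiv ℝ g x‖ ≤ L :=
    fun x hx => hgL₁ x (closedBall_subset_closedBall hrr₁ hx)
  have hrU' : closedBall q₀ r ⊆ U := fun q hq => (hrU (closedBall_subset_closedBall hrr₂ hq)).1
  set Mz : NNReal := ⟨‖z q₀‖ + 1, by positivity⟩ with hMz
  have hzM : ∀ q ∈ closedBall q₀ r, ‖z q‖ ≤ Mz :=
    fun q hq => (hrU (closedBall_subset_closedBall hrr₂ hq)).2
  -- `ρ` solves `Mz * ρ = a - ρ`: a curve of speed at most `Mz * ρ` starting within `ρ` of `q₀`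
  -- stays within `a = r / 2` up to time one. The other half of `r` is the room inside `B` needed to
  -- compare with neighbouring solutions.
  set a : NNReal := ⟨r / 2, by positivity⟩ with ha
  set ρ : NNReal := a / (Mz + 1) with hρ
  have hρpos : (0 : ℝ) < ρ := by
    have h1 : (0 : ℝ) < a := half_pos hr
    simp only [hρ, NNReal.coe_div, NNReal.coe_add, NNReal.coe_one]; positivity
  have hρa : (Mz : ℝ) * ρ = a - ρ := by
    have : ((Mz : ℝ) + 1) ≠ 0 := by positivity
    simp only [hρ, NNReal.coe_div, NNReal.coe_add, NNReal.coe_one]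
    field_simp
    ring
  have har : (a : ℝ) = r / 2 := rfl
  have hρa' : (ρ : ℝ) ≤ r / 2 := by
    have : (0 : ℝ) ≤ Mz * ρ := by positivity
    linarith
  -- the solutions
  have hsol : ∀ p : V × E, ∃ c : ℝ → E, p ∈ ball ((0 : V), q₀) ρ → c 0 = p.2 ∧
      ∀ t ∈ Icc (0 : ℝ) 1, HasDerivWithinAt c (z (c t) p.1) (Icc 0 1) t ∧
        c t ∈ closedBall q₀ (r / 2) := by
    intro p
    by_cases hp : p ∈ ball ((0 : V), q₀) ρ
    swap
    · exact ⟨0, fun h => absurd h hp⟩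
    rw [← ball_prod_same] at hp
    have hp1 : ‖p.1‖ < ρ := by simpa using hp.1
    have hp1r : ‖p.1‖ ≤ r := by linarith
    have hsub : closedBall q₀ (a : ℝ) ⊆ closedBall q₀ r :=
      closedBall_subset_closedBall (by rw [har]; linarith)
    obtain ⟨c, hc⟩ := exists_solution_mem_closedBall (f := fun q => z q p.1) (q₀ := q₀) (q := p.2)
      (a := a) (r := ρ) (L := Mz * ρ) (K := K)
      (fun q hq => by
        refine ((z q).le_of_opNorm_le_of_le (hzM q (hsub hq)) hp1.le).trans_eq (by simp))
      (LipschitzOnWith.of_dist_le_mul fun q hq q' hq' => by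
        have := hlip.dist_le_mul (p.1, q) ((hBmem _).2 ⟨hp1r, hsub hq⟩) (p.1, q')
          ((hBmem _).2 ⟨hp1r, hsub hq'⟩)
        simpa [hg, Prod.dist_eq] using this)
      (by push_cast; exact hρa.le) (ball_subset_closedBall hp.2)
    exact ⟨c, fun _ => hc⟩
  choose c hc using hsol
  set O : Set (V × E) := ball ((0 : V), q₀) ρ with hO
  have hOmem : ∀ p ∈ O, ‖p.1‖ < ρ ∧ p.2 ∈ ball q₀ ρ := fun p hp => by
    rw [hO, ← ball_prod_same] at hp
    exact ⟨by simpa using hp.1, hp.2⟩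
  have hcr : ∀ p ∈ O, ∀ t ∈ Icc (0 : ℝ) 1, c p t ∈ closedBall q₀ r := fun p hp t ht =>
    closedBall_subset_closedBall (by linarith) ((hc p hp).2 t ht).2
  have hcΩ : ∀ p ∈ O, ∀ t ∈ Icc (0 : ℝ) 1, c p t ∈ Ω := fun p hp t ht =>
    hUΩ (hrU' (hcr p hp t ht))
  have hγB : ∀ p ∈ O, ∀ t ∈ Icc (0 : ℝ) 1, (p.1, c p t) ∈ B := fun p hp t ht =>
    (hBmem _).2 ⟨by linarith [(hOmem p hp).1], hcr p hp t ht⟩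
  have hγ : ∀ p ∈ O, ∀ t ∈ Icc (0 : ℝ) 1,
      HasDerivWithinAt (fun t => (p.1, c p t)) (g (p.1, c p t)) (Icc 0 1) t := fun p hp t ht =>
    (hasDerivWithinAt_const t _ p.1).prodMk ((hc p hp).2 t ht).1
  -- solutions of the linearized equation
  have hlin : ∀ p ∈ O, ∀ (Y : V) (W : ℝ → V),
      (∀ t ∈ Icc (0 : ℝ) 1, HasDerivWithinAt W (Y - b p.1 (W t)) (Icc 0 1) t) →
      ∀ t ∈ Icc (0 : ℝ) 1, HasDerivWithinAt (fun t => (Y, z (c p t) (W t)))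
        (fderiv ℝ g (p.1, c p t) (Y, z (c p t) (W t))) (Icc 0 1) t := by
    intro p hp Y W hW t ht
    rw [hg' _ (hcΩ p hp t ht)]
    exact (hasDerivWithinAt_const t _ Y).prodMk
      (hasDerivWithinAt_field_along (hzd _ (hcΩ p hp t ht)) (hb _ (hcΩ p hp t ht))
        ((hc p hp).2 t ht).1 (hW t ht))
  -- Since `z` may have a kernel, `W` is not determined by the tangent vector `z W`. Uniqueness for
  -- the linearized equation shows that only `z p.2 (W 0)` matters for `z (c p 1) (W 1)`.
  have hunique : ∀ p ∈ O, ∀ (Y : V) (W W' : ℝ → V),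
      (∀ t ∈ Icc (0 : ℝ) 1, HasDerivWithinAt W (Y - b p.1 (W t)) (Icc 0 1) t) →
      (∀ t ∈ Icc (0 : ℝ) 1, HasDerivWithinAt W' (Y - b p.1 (W' t)) (Icc 0 1) t) →
      z p.2 (W 0) = z p.2 (W' 0) → z (c p 1) (W 1) = z (c p 1) (W' 1) := by
    intro p hp Y W W' hW hW' h0
    have := eq_zero_of_linear_ODE (A := fun t => fderiv ℝ g (p.1, c p t)) (C := L)
      (u := fun t => ((0 : V), z (c p t) (W t - W' t)))
      (hlin p hp 0 (fun t => W t - W' t) fun t ht => by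
        refine ((hW t ht).sub (hW' t ht)).congr_deriv ?_
        rw [map_sub]; abel)
      (fun t ht => hgL _ (hγB p hp t ht)) (by simp [(hc p hp).1, h0])
    simpa [sub_eq_zero] using this
  have hJ : ∀ q (v : V × E), (ContinuousLinearMap.inl ℝ V V ∘L σ q ∘L ContinuousLinearMap.snd ℝ V E +
      ContinuousLinearMap.inr ℝ V V ∘L ContinuousLinearMap.fst ℝ V E) v = (σ q v.2, v.1) :=
    fun q v => by simp
  -- The derivative of the flow as an explicit function of the starting data `x.1` and the end point
  -- `x.2`; the curve between them does not enter.
  set G : (V × E) × E → V × E →L[ℝ] E := fun x => z x.2 ∘L .fst ℝ V V ∘L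
    exp (affineGenerator (b x.1.1)) ∘L
      (.inl ℝ V V ∘L σ x.1.2 ∘L .snd ℝ V E + .inr ℝ V V ∘L .fst ℝ V E) with hG
  have hexpW : ∀ (X : V) (w : V × V), ∀ t ∈ Icc (0 : ℝ) 1,
      HasDerivWithinAt (fun t : ℝ => (exp (t • affineGenerator (b X)) w).1)
        (w.2 - b X (exp (t • affineGenerator (b X)) w).1) (Icc 0 1) t := fun X w t _ =>
    (hasDerivAt_fst_exp_affineGenerator (b X) w t).hasDerivWithinAt
  have hOo : IsOpen O := isOpen_ball
  have hOU : ∀ p ∈ O, p.2 ∈ U := fun p hp =>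
    hrU' (closedBall_subset_closedBall (by linarith) (ball_subset_closedBall (hOmem p hp).2))
  have h0O : (0, q₀) ∈ O := mem_ball_self hρpos
  have h01 : (0 : ℝ) ∈ Icc (0 : ℝ) 1 := by simp
  have h11 : (1 : ℝ) ∈ Icc (0 : ℝ) 1 := by simp
  have hF : ∀ p ∈ O, HasFDerivAt (fun p => c p 1) (G (p, c p 1)) p := by
    intro p hp
    set D : ℝ → V × E →L[ℝ] V × E := fun t => .inl ℝ V E ∘L .fst ℝ V E + .inr ℝ V E ∘L
      z (c p t) ∘L .fst ℝ V V ∘L exp (t • affineGenerator (b p.1)) ∘L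
      (.inl ℝ V V ∘L σ p.2 ∘L .snd ℝ V E + .inr ℝ V V ∘L .fst ℝ V E) with hD
    have hDv : ∀ t v, D t v =
        (v.1, z (c p t) (exp (t • affineGenerator (b p.1)) (σ p.2 v.2, v.1)).1) := fun t v => by
      simp only [hD, _root_.add_apply (_ ∘L _) (_ ∘L _ ∘L _ ∘L _ ∘L _),
        ContinuousLinearMap.comp_apply, hJ]
      simp
    have hDc : ContinuousOn D (Icc 0 1) := by
      have h1 : ContinuousOn (fun t => z (c p t)) (Icc 0 1) :=
        hz.continuousOn.comp (fun t ht => ((hc p hp).2 t ht).1.continuousWithinAt)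
          (fun t ht => hcΩ p hp t ht)
      have h2 : Continuous fun t : ℝ => exp (t • affineGenerator (b p.1)) :=
        contDiff_exp_clm.continuous.comp (by fun_prop)
      exact continuousOn_const.add (continuousOn_const.clm_comp (h1.clm_comp
        (continuousOn_const.clm_comp (h2.continuousOn.clm_comp continuousOn_const))))
    obtain ⟨C, hC⟩ := isCompact_Icc.exists_bound_of_continuousOn hDc
    have hrhalf : (0 : ℝ) < r / 2 := half_pos hr
    have key := hasFDerivAt_time_one (g := g) (B := B) (K := K) (L := L) (C := C) (r := r / 2) hL
      hlip hquad (γ := fun p t => (p.1, c p t)) (p := p) hrhalf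
      (Filter.eventually_of_mem (hOo.mem_nhds hp) fun q hq =>
        ⟨by simp [(hc q hq).1], fun t ht => ⟨hγ q hq t ht, hγB q hq t ht⟩⟩)
      (fun t ht => by
        refine (ball_subset_closedBall).trans (closedBall_subset_closedBall' ?_)
        have h1 : ‖p.1‖ ≤ r / 2 := by linarith [(hOmem p hp).1]
        have h2 := mem_closedBall.1 ((hc p hp).2 t ht).2
        have h3 : dist (p.1, c p t) (0, q₀) ≤ r / 2 := by
          rw [Prod.dist_eq]; exact max_le (by simpa using h1) h2
        linarith)
      (D := D) (ContinuousLinearMap.ext fun v => by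
        rw [hDv, (hc p hp).1, zero_smul, exp_zero]
        simp [hσz p.2 (hOU p hp)])
      (fun v t ht => by
        simp only [hDv]
        exact hlin p hp v.1 _ (hexpW p.1 (σ p.2 v.2, v.1)) t ht)
      hC
    have h2 := (hasFDerivAt_snd (𝕜 := ℝ) (E := V) (F := E)).comp p key
    refine HasFDerivAt.congr_fderiv h2 (ContinuousLinearMap.ext fun v => ?_)
    have := congrArg Prod.snd (hDv 1 v)
    rw [one_smul] at this
    simp only [hG, ContinuousLinearMap.comp_apply, hJ]
    exact this
  have hGS : ContDiffOn ℝ ∞ G {x | x.1.2 ∈ U ∧ x.2 ∈ Ω} := by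
    have h1 : ContDiffOn ℝ ∞ (fun x : (V × E) × E => z x.2) {x | x.1.2 ∈ U ∧ x.2 ∈ Ω} :=
      hz.comp contDiffOn_snd fun x hx => hx.2
    have h2 : ContDiffOn ℝ ∞ (fun x : (V × E) × E => σ x.1.2) {x | x.1.2 ∈ U ∧ x.2 ∈ Ω} :=
      hσ.comp (contDiff_snd.comp contDiff_fst).contDiffOn fun x hx => hx.1
    have h3 : ContDiff ℝ ∞ fun x : (V × E) × E => exp (affineGenerator (b x.1.1)) := by
      refine contDiff_exp_clm.comp ?_
      unfold affineGenerator
      exact contDiff_const.clm_comp (contDiff_const.sub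
        ((b.contDiff.comp (contDiff_fst.comp contDiff_fst)).clm_comp contDiff_const))
    exact h1.clm_comp (contDiffOn_const.clm_comp (h3.contDiffOn.clm_comp
      ((contDiffOn_const.clm_comp (h2.clm_comp contDiffOn_const)).add contDiffOn_const)))
  have hGv : ∀ p y v, G (p, y) v = z y (exp (affineGenerator (b p.1)) (σ p.2 v.2, v.1)).1 :=
    fun p y v => by simp only [hG, ContinuousLinearMap.comp_apply, hJ]; rfl
  have hc0 : c (0, q₀) 1 = q₀ := by
    have := constant_of_derivWithin_zero (f := c (0, q₀)) (a := 0) (b := 1)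
      (fun t ht => ((hc _ h0O).2 t ht).1.differentiableWithinAt)
      (fun t ht => by
        have h := ((hc _ h0O).2 t (Ico_subset_Icc_self ht)).1
        simpa using h.derivWithin (uniqueDiffOn_Icc_zero_one t (Ico_subset_Icc_self ht))) 1 h11
    rw [this, (hc _ h0O).1]
  refine ⟨O, fun p => c p 1, hOo, h0O,
    contDiffOn_of_hasFDerivAt_self hOo hGS (fun p hp => ⟨hOU p hp, hcΩ p hp 1 h11⟩) hF, hc0,
    fun Y => ?_, fun p hp => ⟨c p, (hc p hp).1, rfl, fun t ht =>
      ⟨hcΩ p hp t ht, ((hc p hp).2 t ht).1⟩⟩, fun p hp Y => ?_⟩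
  · rw [(hF _ h0O).fderiv, hGv]
    -- For `X = 0` the linearized equation is `W' = Y`, with solution `t • Y`.
    have := hunique _ h0O Y (fun t => (exp (t • affineGenerator (b 0)) (σ q₀ 0, Y)).1)
      (fun t => t • Y) (hexpW 0 _) (fun t ht => by
        simpa using ((hasDerivAt_id t).smul_const Y).hasDerivWithinAt) (by simp)
    simpa [hc0] using this
  · rw [(hF _ hp).fderiv, hGv]
    -- With no variation of the parameter the equation is `W' = -b X W`, solved by `exp (-t b X) Y`.
    have := hunique _ hp 0 (fun t => (exp (t • affineGenerator (b p.1)) (σ p.2 (z p.2 Y), 0)).1)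
      (fun t => exp (t • (-b p.1)) Y) (hexpW p.1 _) (fun t ht => by
        simpa using (hasDerivAt_exp_smul_apply (-b p.1) Y t).hasDerivWithinAt)
        (by simp [hσz p.2 (hOU p hp)])
    simpa using this

end LocalFlow

/-! ### Transitive families of vector fields in a chart. -/

section ChartRepresentation

open Set VectorField

variable {V : Type*} [NormedAddCommGroup V] [NormedSpace ℝ V]
  {E : Type*} [NormedAddCommGroup E] [NormedSpace ℝ E]
  {M : Type*} [TopologicalSpace M] [ChartedSpace E M] [IsManifold 𝓘(ℝ, E) ∞ M]

/-- The linear family `Z` of smooth vector fields spans every tangent space and is closed under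
the Lie bracket, with structure map `b`. -/
structure IsTransitiveFamily (b : V →L[ℝ] V →L[ℝ] V)
    (Z : V →ₗ[ℝ] ∀ x : M, TangentSpace 𝓘(ℝ, E) x) : Prop where
  smooth : ∀ Y, IsSmoothField (Z Y)
  bracket : ∀ X Y, Z (b X Y) = mlieBracket 𝓘(ℝ, E) (Z X) (Z Y)
  surjective : ∀ x, Function.Surjective fun Y => Z Y x

lemma mdifferentiable_chartAt (m₀ : M) :
    (chartAt E m₀).MDifferentiable 𝓘(ℝ, E) 𝓘(ℝ, E) :=
  mdifferentiable_chart m₀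

/-- The family `Z` in the chart around `m₀`. -/
def chartFamily [FiniteDimensional ℝ V] (Z : V →ₗ[ℝ] ∀ x : M, TangentSpace 𝓘(ℝ, E) x) (m₀ : M)
    (p : E) : V →L[ℝ] E :=
  LinearMap.toContinuousLinearMap
    { toFun := fun Y => mfderiv 𝓘(ℝ, E) 𝓘(ℝ, E) (chartAt E m₀) ((chartAt E m₀).symm p)
        (Z Y ((chartAt E m₀).symm p))
      map_add' := fun X Y => by rw [map_add]; exact map_add _ _ _
      map_smul' := fun a Y => by rw [map_smul]; exact map_smul _ _ _ }

variable [FiniteDimensional ℝ V] {b : V →L[ℝ] V →L[ℝ] V}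
  {Z : V →ₗ[ℝ] ∀ x : M, TangentSpace 𝓘(ℝ, E) x}

lemma chartFamily_apply (m₀ : M) (p : E) (Y : V) :
    chartFamily Z m₀ p Y = mfderiv 𝓘(ℝ, E) 𝓘(ℝ, E) (chartAt E m₀) ((chartAt E m₀).symm p)
        (Z Y ((chartAt E m₀).symm p)) := rfl

lemma mfderiv_chartAt_family {m₀ m : M} (hm : m ∈ (chartAt E m₀).source) (Y : V) :
    mfderiv 𝓘(ℝ, E) 𝓘(ℝ, E) (chartAt E m₀) m (Z Y m) = chartFamily Z m₀ (chartAt E m₀ m) Y := by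
  rw [chartFamily_apply, (chartAt E m₀).left_inv hm]

lemma mfderiv_chartAt_symm_family {m₀ : M} {p : E} (hp : p ∈ (chartAt E m₀).target) (Y : V) :
    mfderiv 𝓘(ℝ, E) 𝓘(ℝ, E) (chartAt E m₀).symm p (chartFamily Z m₀ p Y)
      = Z Y ((chartAt E m₀).symm p) := by
  have h := (mdifferentiable_chartAt m₀).symm_comp_deriv ((chartAt E m₀).map_target hp)
  rw [(chartAt E m₀).right_inv hp] at h
  exact congrArg (fun A => A (Z Y ((chartAt E m₀).symm p))) h

/-- Seeing the chart expression as a pullback makes the smoothness of pullbacks and the naturality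
of the Lie bracket applicable to it. -/
lemma chartFamily_eq_mpullback {m₀ : M} {p : E} (hp : p ∈ (chartAt E m₀).target) (Y : V) :
    chartFamily Z m₀ p Y = mpullback 𝓘(ℝ, E) 𝓘(ℝ, E) (chartAt E m₀).symm (Z Y) p := by
  have h : (mfderiv 𝓘(ℝ, E) 𝓘(ℝ, E) (chartAt E m₀).symm p).inverse =
      mfderiv 𝓘(ℝ, E) 𝓘(ℝ, E) (chartAt E m₀) ((chartAt E m₀).symm p) := by
    refine ContinuousLinearMap.inverse_eq ?_ ?_
    · have h := (mdifferentiable_chartAt m₀).symm_comp_deriv ((chartAt E m₀).map_target hp)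
      rwa [(chartAt E m₀).right_inv hp] at h
    · exact (mdifferentiable_chartAt m₀).comp_symm_deriv hp
  exact (congrArg (fun A => A (Z Y ((chartAt E m₀).symm p))) h).symm

lemma chartFamily_surjective (hZ : IsTransitiveFamily b Z) {m₀ : M} {p : E}
    (hp : p ∈ (chartAt E m₀).target) : Function.Surjective (chartFamily Z m₀ p) := by
  intro v
  obtain ⟨Y, hY⟩ := hZ.surjective ((chartAt E m₀).symm p)
    (mfderiv 𝓘(ℝ, E) 𝓘(ℝ, E) (chartAt E m₀).symm p v)
  refine ⟨Y, ?_⟩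
  rw [chartFamily_apply]
  have h := (mdifferentiable_chartAt m₀).comp_symm_deriv hp
  have h2 := congrArg (fun A => A v) h
  dsimp only at hY
  rw [hY]
  exact h2

lemma isInvertible_mfderiv_chartAt_symm {m₀ : M} {p : E} (hp : p ∈ (chartAt E m₀).target) :
    (mfderiv 𝓘(ℝ, E) 𝓘(ℝ, E) (chartAt E m₀).symm p).IsInvertible :=
  ⟨(mdifferentiable_chartAt m₀).symm.mfderiv hp, rfl⟩

lemma contMDiffAt_chartAt_symm {m₀ : M} {p : E} (hp : p ∈ (chartAt E m₀).target) :
    ContMDiffAt 𝓘(ℝ, E) 𝓘(ℝ, E) ∞ (chartAt E m₀).symm p :=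
  contMDiffOn_chart_symm.contMDiffAt ((chartAt E m₀).open_target.mem_nhds hp)

lemma contMDiffAt_chartAt {m₀ m : M} (hm : m ∈ (chartAt E m₀).source) :
    ContMDiffAt 𝓘(ℝ, E) 𝓘(ℝ, E) ∞ (chartAt E m₀) m :=
  contMDiffOn_chart.contMDiffAt ((chartAt E m₀).open_source.mem_nhds hm)

variable [FiniteDimensional ℝ E]

lemma contDiffOn_chartFamily (hZ : IsTransitiveFamily b Z) (m₀ : M) :
    ContDiffOn ℝ ∞ (chartFamily Z m₀) (chartAt E m₀).target := by
  have := FiniteDimensional.complete ℝ E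
  rw [contDiffOn_clm_apply]
  intro Y p hp
  have h := ContMDiffAt.mpullback_vectorField_preimage (m := ∞) (n := ∞) (I := 𝓘(ℝ, E))
    (I' := 𝓘(ℝ, E)) (V := Z Y)
    (f := (chartAt E m₀).symm) (x₀ := p) (hZ.smooth Y _) (contMDiffAt_chartAt_symm hp)
    (isInvertible_mfderiv_chartAt_symm hp) (by simp)
  have h2 := (contMDiffAt_vectorSpace_iff_contDiffAt).1 h
  refine h2.contDiffWithinAt.congr_of_mem (fun q hq => ?_) hp
  exact chartFamily_eq_mpullback hq Y

lemma chartFamily_bracket (hZ : IsTransitiveFamily b Z) {m₀ : M} {p : E}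
    (hp : p ∈ (chartAt E m₀).target) (X Y : V) :
    fderiv ℝ (chartFamily Z m₀) p (chartFamily Z m₀ p X) Y
      - fderiv ℝ (chartFamily Z m₀) p (chartFamily Z m₀ p Y) X = chartFamily Z m₀ p (b X Y) := by
  have := FiniteDimensional.complete ℝ E
  have hz : DifferentiableAt ℝ (chartFamily Z m₀) p :=
    ((contDiffOn_chartFamily hZ m₀).contDiffAt
      ((chartAt E m₀).open_target.mem_nhds hp)).differentiableAt (by simp)
  have hd : ∀ X v, fderiv ℝ (fun q => chartFamily Z m₀ q X) p v
      = fderiv ℝ (chartFamily Z m₀) p v X := fun X v => by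
    rw [fderiv_clm_apply hz (differentiableAt_const X)]
    simp
  have h1 : chartFamily Z m₀ p (b X Y) = lieBracket ℝ (fun q => chartFamily Z m₀ q X)
      (fun q => chartFamily Z m₀ q Y) p := by
    have hM2 : IsManifold 𝓘(ℝ, E) (minSmoothness ℝ 2) M := by
      rw [minSmoothness_of_isRCLikeNormedField]; exact IsManifold.of_le (n := ∞) ENat.LEInfty.out
    have hM3 : IsManifold 𝓘(ℝ, E) (minSmoothness ℝ 3) M := by
      rw [minSmoothness_of_isRCLikeNormedField]; exact IsManifold.of_le (n := ∞) ENat.LEInfty.out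
    rw [chartFamily_eq_mpullback hp, hZ.bracket]
    have h2 := mpullback_mlieBracket (I := 𝓘(ℝ, E)) (I' := 𝓘(ℝ, E)) (V := Z X) (W := Z Y)
      (f := (chartAt E m₀).symm) (x₀ := p) (n := ∞)
      ((hZ.smooth X _).mdifferentiableAt (by simp)) ((hZ.smooth Y _).mdifferentiableAt (by simp))
      (contMDiffAt_chartAt_symm hp) (by
        rw [minSmoothness_of_isRCLikeNormedField]; exact ENat.LEInfty.out)
    rw [h2, ← mlieBracketWithin_univ, mlieBracketWithin_eq_lieBracketWithin]
    refine (congrFun (lieBracketWithin_univ (𝕜 := ℝ) (V := mpullback 𝓘(ℝ, E) 𝓘(ℝ, E)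
      (chartAt E m₀).symm (Z X)) (W := mpullback 𝓘(ℝ, E) 𝓘(ℝ, E)
      (chartAt E m₀).symm (Z Y))) p).trans ?_
    have hev : ∀ Y : V, (mpullback 𝓘(ℝ, E) 𝓘(ℝ, E) (chartAt E m₀).symm (Z Y)) =ᶠ[𝓝 p]
        fun q => chartFamily Z m₀ q Y := fun Y =>
      Filter.eventually_of_mem ((chartAt E m₀).open_target.mem_nhds hp)
        fun q hq => (chartFamily_eq_mpullback hq Y).symm
    exact Filter.EventuallyEq.lieBracket_vectorField_eq (hev X) (hev Y)
  rw [h1, lieBracket_eq]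
  simp only [hd]

end ChartRepresentation

/-! ### Integral curves on closed intervals and their uniqueness. -/

section IntegralCurves

open Set VectorField

variable {V : Type*} [NormedAddCommGroup V] [NormedSpace ℝ V] [FiniteDimensional ℝ V]
  {E : Type*} [NormedAddCommGroup E] [NormedSpace ℝ E]
  {M : Type*} [TopologicalSpace M] [ChartedSpace E M] [IsManifold 𝓘(ℝ, E) ∞ M]
  {b : V →L[ℝ] V →L[ℝ] V} {Z : V →ₗ[ℝ] ∀ x : M, TangentSpace 𝓘(ℝ, E) x}

/-- The local flow of `v` at time `t` is defined at `y` and maps it to `z`. -/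
def FlowsAlong (v : ∀ x : M, TangentSpace 𝓘(ℝ, E) x) (t : ℝ) (y z : M) : Prop :=
  ∃ c : ℝ → M, IsMIntegralCurveOn (I := 𝓘(ℝ, E)) c v (uIcc 0 t) ∧ c 0 = y ∧ c t = z

lemma hasDerivWithinAt_chartAt_comp {m₀ : M} {c : ℝ → M} {X : V} {s : Set ℝ}
    (hc : IsMIntegralCurveOn (I := 𝓘(ℝ, E)) c (Z X) s) {t : ℝ} (ht : t ∈ s)
    (hm : c t ∈ (chartAt E m₀).source) :
    HasDerivWithinAt (chartAt E m₀ ∘ c) (chartFamily Z m₀ (chartAt E m₀ (c t)) X) s t := by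
  have h := HasMFDerivWithinAt.comp t
    ((mdifferentiable_chartAt m₀).mdifferentiableAt hm).hasMFDerivAt.hasMFDerivWithinAt
    (hc t ht) (subset_preimage_image c s)
  have h2 (a : ℝ) : mfderiv 𝓘(ℝ, E) 𝓘(ℝ, E) (chartAt E m₀) (c t) (a • Z X (c t)) =
      a • chartFamily Z m₀ (chartAt E m₀ (c t)) X := by
    rw [map_smul]
    exact congrArg (a • ·) (mfderiv_chartAt_family hm X)
  have h3 : HasMFDerivWithinAt 𝓘(ℝ, ℝ) 𝓘(ℝ, E) (chartAt E m₀ ∘ c) s t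
      (ContinuousLinearMap.toSpanSingleton ℝ (chartFamily Z m₀ (chartAt E m₀ (c t)) X)) :=
    h.congr_mfderiv (ContinuousLinearMap.ext fun a : ℝ => h2 a)
  exact hasDerivWithinAt_iff_hasFDerivWithinAt.2 h3.hasFDerivWithinAt

lemma isMIntegralCurveOn_chartAt_symm_comp {m₀ : M} {u : ℝ → E} {X : V} {s : Set ℝ}
    (hu : ∀ t ∈ s, u t ∈ (chartAt E m₀).target ∧
      HasDerivWithinAt u (chartFamily Z m₀ (u t) X) s t) :
    IsMIntegralCurveOn (I := 𝓘(ℝ, E)) ((chartAt E m₀).symm ∘ u) (Z X) s := by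
  intro t ht
  have h := HasMFDerivWithinAt.comp t
    ((mdifferentiable_chartAt m₀).mdifferentiableAt_symm (hu t ht).1).hasMFDerivAt.hasMFDerivWithinAt
    (hu t ht).2.hasFDerivWithinAt.hasMFDerivWithinAt (subset_preimage_image u s)
  refine h.congr_mfderiv (ContinuousLinearMap.ext fun a : ℝ => ?_)
  have h2 : mfderiv 𝓘(ℝ, E) 𝓘(ℝ, E) (chartAt E m₀).symm (u t) (a • chartFamily Z m₀ (u t) X) =
      a • Z X ((chartAt E m₀).symm (u t)) := by
    rw [← mfderiv_chartAt_symm_family (hu t ht).1 X]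
    exact map_smul _ _ _
  exact h2

lemma FlowsAlong.time_one {v : ∀ x : M, TangentSpace 𝓘(ℝ, E) x} {t : ℝ} {y z : M}
    (h : FlowsAlong v t y z) : FlowsAlong (t • v) 1 y z := by
  obtain ⟨c, hc, h0, h1⟩ := h
  refine ⟨c ∘ (· * t), (hc.comp_mul t).mono fun s hs => ?_, by simpa using h0, by simpa using h1⟩
  rw [uIcc_of_le zero_le_one] at hs
  show s * t ∈ uIcc 0 t
  rcases le_total 0 t with h | h
  · rw [uIcc_of_le h]; exact ⟨by nlinarith [hs.1], by nlinarith [hs.2]⟩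
  · rw [uIcc_of_ge h]; exact ⟨by nlinarith [hs.2], by nlinarith [hs.1]⟩

lemma FlowsAlong.reverse {v : ∀ x : M, TangentSpace 𝓘(ℝ, E) x} {y z : M}
    (h : FlowsAlong v 1 y z) : FlowsAlong (-v) 1 z y := by
  obtain ⟨c, hc, h0, h1⟩ := h
  have h2 := (hc.comp_mul (-1)).comp_add (-1)
  refine ⟨(c ∘ (· * -1)) ∘ (· + -1), ?_, ?_, ?_⟩
  · rw [← neg_one_smul ℝ v]
    refine h2.mono fun s hs => ?_
    rw [uIcc_of_le zero_le_one] at hs ⊢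
    show (s + -1) * (-1) ∈ Icc (0 : ℝ) 1
    exact ⟨by linarith [hs.2], by linarith [hs.1]⟩
  · simpa using h1
  · simpa using h0

variable [FiniteDimensional ℝ E]

/-- The set of times where the curves agree is closed because `M` is Hausdorff. It extends to the
right of each of its points before `1`, because in a chart the field is locally Lipschitz and the
initial value problem has one forward solution. -/
lemma integralCurve_eqOn_Icc [T2Space M] (hZ : IsTransitiveFamily b Z) {X : V} {c c' : ℝ → M}
    (hc : IsMIntegralCurveOn (I := 𝓘(ℝ, E)) c (Z X) (Icc 0 1))
    (hc' : IsMIntegralCurveOn (I := 𝓘(ℝ, E)) c' (Z X) (Icc 0 1)) (h0 : c 0 = c' 0) :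
    ∀ t ∈ Icc (0 : ℝ) 1, c t = c' t := by
  have hcl : IsClosed ({t | c t = c' t} ∩ Icc (0 : ℝ) 1) := by
    have := (hc.continuousOn.prodMk hc'.continuousOn).preimage_isClosed_of_isClosed isClosed_Icc
      (isClosed_diagonal (X := M))
    rwa [inter_comm] at this
  refine hcl.Icc_subset_of_forall_mem_nhdsWithin h0 fun t₀ ht₀ => ?_
  obtain ⟨heq, ht₀⟩ := ht₀
  have ht₀' := Ico_subset_Icc_self ht₀
  set m₀ := c t₀ with hm₀
  set κ := chartAt E m₀
  have hzd : ContDiffAt ℝ 1 (fun q => chartFamily Z m₀ q X) (κ m₀) :=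
    ((((contDiffOn_chartFamily hZ m₀).contDiffAt (κ.open_target.mem_nhds
      (κ.map_source (mem_chart_source E m₀)))).clm_apply contDiffAt_const)).of_le
      ENat.LEInfty.out
  obtain ⟨K, s, hs, hK⟩ := hzd.exists_lipschitzOnWith
  have hev : ∀ {d : ℝ → M}, IsMIntegralCurveOn (I := 𝓘(ℝ, E)) d (Z X) (Icc 0 1) → d t₀ = m₀ →
      ∀ᶠ t in 𝓝[≥] t₀, t ∈ Icc (0 : ℝ) 1 ∧ d t ∈ κ.source ∧ κ (d t) ∈ s := by
    intro d hd hd0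
    have h1 : ContinuousWithinAt d (Icc 0 1) t₀ := hd.continuousOn t₀ ht₀'
    have hle : 𝓝[≥] t₀ ≤ 𝓝[Icc 0 1] t₀ := by
      rw [← nhdsWithin_Icc_eq_nhdsGE ht₀.2]
      exact nhdsWithin_mono _ (Icc_subset_Icc_left ht₀.1)
    have h2 : Filter.Tendsto d (𝓝[≥] t₀) (𝓝 m₀) := hd0 ▸ h1.mono_left hle
    have h3 : ∀ᶠ m in 𝓝 m₀, m ∈ κ.source ∧ κ m ∈ s :=
      Filter.Eventually.and (κ.open_source.mem_nhds (mem_chart_source E m₀))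
        ((κ.continuousAt (mem_chart_source E m₀)).preimage_mem_nhds hs)
    exact Filter.Eventually.and (hle self_mem_nhdsWithin) (h2.eventually h3)
  have hev2 := (hev hc rfl).and (hev hc' heq.symm)
  obtain ⟨t₁, ht₁, hsub⟩ := mem_nhdsGE_iff_exists_Icc_subset.1 hev2
  have hd : ∀ {d : ℝ → M}, IsMIntegralCurveOn (I := 𝓘(ℝ, E)) d (Z X) (Icc 0 1) →
      (∀ t ∈ Icc t₀ t₁, t ∈ Icc (0 : ℝ) 1 ∧ d t ∈ κ.source ∧ κ (d t) ∈ s) →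
      ∀ t ∈ Icc t₀ t₁, HasDerivWithinAt (κ ∘ d) (chartFamily Z m₀ ((κ ∘ d) t) X) (Icc t₀ t₁) t :=
    fun {d} hd h t ht => (hasDerivWithinAt_chartAt_comp hd (h t ht).1 (h t ht).2.1).mono
      fun r hr => (h r hr).1
  have hIci : ∀ {u : ℝ → E} {u' : E} {t : ℝ}, t ∈ Ico t₀ t₁ →
      HasDerivWithinAt u u' (Icc t₀ t₁) t → HasDerivWithinAt u u' (Ici t) t := fun ht h =>
    (h.mono (Icc_subset_Icc_left ht.1)).mono_of_mem_nhdsWithin (Icc_mem_nhdsGE ht.2)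
  have h1 := hd hc fun t ht => (hsub ht).1
  have h2 := hd hc' fun t ht => (hsub ht).2
  have key := ODE_solution_unique_of_mem_Icc_right (v := fun _ q => chartFamily Z m₀ q X)
    (s := fun _ => s) (K := K) (f := κ ∘ c) (g := κ ∘ c') (a := t₀) (b := t₁) (fun _ _ => hK)
    (fun t ht => (h1 t ht).continuousWithinAt) (fun t ht => hIci ht (h1 t (Ico_subset_Icc_self ht)))
    (fun t ht => (hsub (Ico_subset_Icc_self ht)).1.2.2)
    (fun t ht => (h2 t ht).continuousWithinAt) (fun t ht => hIci ht (h2 t (Ico_subset_Icc_self ht)))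
    (fun t ht => (hsub (Ico_subset_Icc_self ht)).2.2.2) (congrArg κ heq)
  refine Filter.mem_of_superset (Icc_mem_nhdsGT ht₁) fun t ht => ?_
  exact κ.injOn (hsub ht).1.2.1 (hsub ht).2.2.1 (key ht)

lemma FlowsAlong.unique [T2Space M] (hZ : IsTransitiveFamily b Z) {X : V} {t : ℝ} {y z z' : M}
    (h : FlowsAlong (Z X) t y z) (h' : FlowsAlong (Z X) t y z') : z = z' := by
  obtain ⟨c, hc, h0, rfl⟩ := h.time_one
  obtain ⟨c', hc', h0', rfl⟩ := h'.time_one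
  rw [← map_smul, uIcc_of_le zero_le_one] at hc hc'
  exact integralCurve_eqOn_Icc hZ hc hc' (h0.trans h0'.symm) 1 (by simp)

end IntegralCurves

/-! ### Local flows on the manifold. -/

section ManifoldFlow

open Set VectorField NormedSpace

variable {V : Type*} [NormedAddCommGroup V] [NormedSpace ℝ V] [FiniteDimensional ℝ V]
  {E : Type*} [NormedAddCommGroup E] [NormedSpace ℝ E] [FiniteDimensional ℝ E]
  {M : Type*} [TopologicalSpace M] [ChartedSpace E M] [IsManifold 𝓘(ℝ, E) ∞ M]
  {b : V →L[ℝ] V →L[ℝ] V} {Z : V →ₗ[ℝ] ∀ x : M, TangentSpace 𝓘(ℝ, E) x}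

/-- Composed with a linear right inverse of its derivative, `h` has derivative the identity, and the
inverse function theorem applies. -/
lemma exists_smooth_section_of_surjective {h : V → E} {A : V →L[ℝ] E}
    (hh : ContDiffAt ℝ ∞ h 0) (hA : HasFDerivAt h A 0) (hs : Function.Surjective A) :
    ∃ τ : E → V, ContDiffAt ℝ ∞ τ (h 0) ∧ τ (h 0) = 0 ∧ ∀ᶠ q in 𝓝 (h 0), h (τ q) = q := by
  have := FiniteDimensional.complete ℝ E
  obtain ⟨s, hs⟩ := A.toLinearMap.exists_rightInverse_of_surjective (LinearMap.range_eq_top.2 hs)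
  let s' : E →L[ℝ] V := LinearMap.toContinuousLinearMap s
  have hh' : ContDiffAt ℝ ∞ (fun v => h (s' v)) 0 :=
    ContDiffAt.comp 0 (by rwa [map_zero]) s'.contDiff.contDiffAt
  have hd : HasFDerivAt (fun v => h (s' v)) (ContinuousLinearEquiv.refl ℝ E : E →L[ℝ] E) 0 := by
    have h1 : HasFDerivAt (fun v => h (s' v)) (A ∘L s') 0 :=
      HasFDerivAt.comp 0 (by rwa [map_zero]) s'.hasFDerivAt
    refine h1.congr_fderiv (ContinuousLinearMap.ext fun v => ?_)
    exact LinearMap.congr_fun hs v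
  have h0 : h (s' 0) = h 0 := by rw [map_zero]
  refine ⟨fun q => s' (hh'.localInverse hd (by simp) q), ?_, ?_, ?_⟩
  · have := hh'.to_localInverse hd (by simp)
    rw [h0] at this
    exact s'.contDiff.contDiffAt.comp _ this
  · have := hh'.localInverse_apply_image hd (by simp)
    rw [h0] at this
    exact (congrArg s' this).trans (map_zero s')
  · have := (hh'.hasStrictFDerivAt' hd (by simp)).eventually_right_inverse
    rw [h0] at this
    exact this

/-- The local flow of the chart, carried back to `M`. Since `X ↦ F X m₀` is a submersion at `0`, it
has a smooth section `τ`: each `m` near `m₀` is reached from `m₀` by the flow of `Z (τ m)`. -/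
theorem exists_flow_family (hZ : IsTransitiveFamily b Z) (m₀ : M) :
    ∃ (F : V → M → M) (τ : M → V),
      (∀ᶠ p : V × M in 𝓝 (0, m₀), FlowsAlong (Z p.1) 1 p.2 (F p.1 p.2) ∧
        ContMDiffAt 𝓘(ℝ, E) 𝓘(ℝ, E) ∞ (F p.1) p.2 ∧
        ∀ Y, mfderiv 𝓘(ℝ, E) 𝓘(ℝ, E) (F p.1) p.2 (Z Y p.2) = Z (exp (-b p.1) Y) (F p.1 p.2)) ∧
      F 0 m₀ = m₀ ∧
      (∃ A : V →L[ℝ] TangentSpace 𝓘(ℝ, E) m₀, (∀ Y, A Y = Z Y m₀) ∧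
        HasMFDerivAt 𝓘(ℝ, V) 𝓘(ℝ, E) (fun X => F X m₀) 0 A) ∧
      ContMDiffAt 𝓘(ℝ, E) 𝓘(ℝ, V) ∞ τ m₀ ∧ τ m₀ = 0 ∧ ∀ᶠ m in 𝓝 m₀, F (τ m) m₀ = m := by
  have := FiniteDimensional.complete ℝ V
  set κ := chartAt E m₀ with hκ
  have hmκ : m₀ ∈ κ.source := mem_chart_source E m₀
  have hκm : κ m₀ ∈ κ.target := κ.map_source hmκ
  obtain ⟨O, F, hO, h0O, hF, hF0, hFX, hFc, hFY⟩ := exists_local_flow (b := b) κ.open_target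
    (contDiffOn_chartFamily hZ m₀) hκm (chartFamily_surjective hZ hκm)
    (fun q hq => chartFamily_bracket hZ hq)
  have hFd : ∀ p ∈ O, ContDiffAt ℝ ∞ F p := fun p hp => hF.contDiffAt (hO.mem_nhds hp)
  have hFt : ∀ p ∈ O, F p ∈ κ.target := fun p hp => by
    obtain ⟨c, -, h1, h⟩ := hFc p hp
    rw [← h1]
    exact (h 1 (by simp)).1
  have hA : HasFDerivAt (fun X => F (X, κ m₀)) (chartFamily Z m₀ (κ m₀)) 0 := by
    have h1 : HasFDerivAt (fun X : V => F (X, κ m₀))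
        (fderiv ℝ F (0, κ m₀) ∘L ContinuousLinearMap.inl ℝ V E) 0 :=
      HasFDerivAt.comp (0 : V) ((hFd _ h0O).differentiableAt (by simp)).hasFDerivAt
        (hasFDerivAt_prodMk_left (0 : V) (κ m₀))
    refine h1.congr_fderiv (ContinuousLinearMap.ext fun Y => ?_)
    exact hFX Y
  have hh : ContDiffAt ℝ ∞ (fun X => F (X, κ m₀)) 0 :=
    (hFd _ h0O).comp (0 : V) (contDiffAt_id.prodMk contDiffAt_const)
  obtain ⟨τ, hτ, hτ0, hτr⟩ := exists_smooth_section_of_surjective hh hA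
    (chartFamily_surjective hZ hκm)
  rw [hF0] at hτ hτ0 hτr
  refine ⟨fun X m => κ.symm (F (X, κ m)), fun m => τ (κ m), ?_, ?_, ?_, ?_, hτ0, ?_⟩
  · have hc : Filter.Tendsto (fun p : V × M => (p.1, κ p.2)) (𝓝 (0, m₀)) (𝓝 (0, κ m₀)) :=
      ContinuousAt.prodMk continuousAt_fst ((κ.continuousAt hmκ).comp continuousAt_snd)
    have hs : ∀ᶠ p : V × M in 𝓝 (0, m₀), p.2 ∈ κ.source :=
      continuousAt_snd.eventually (κ.open_source.mem_nhds hmκ)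
    filter_upwards [hc.eventually (hO.mem_nhds h0O), hs] with p hp hps
    refine ⟨?_, ?_, fun Y => ?_⟩
    · obtain ⟨c, h0, h1, h⟩ := hFc _ hp
      refine ⟨κ.symm ∘ c, isMIntegralCurveOn_chartAt_symm_comp fun t ht => ?_, ?_, ?_⟩
      · rw [uIcc_of_le zero_le_one] at ht ⊢
        exact h t ht
      · rw [Function.comp_apply, h0]; exact κ.left_inv hps
      · rw [Function.comp_apply, h1]
    · have h1 : ContDiffAt ℝ ∞ (fun q => F (p.1, q)) (κ p.2) :=
        (hFd _ hp).comp _ (contDiffAt_const.prodMk contDiffAt_id)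
      have h2 : ContMDiffAt 𝓘(ℝ, E) 𝓘(ℝ, E) ∞ (fun m => F (p.1, κ m)) p.2 :=
        h1.contMDiffAt.comp p.2 (contMDiffAt_chartAt hps)
      exact ContMDiffAt.comp p.2 (contMDiffAt_chartAt_symm (hFt _ hp)) h2
    · have h1 : HasFDerivAt (fun q : E => F (p.1, q))
          (fderiv ℝ F (p.1, κ p.2) ∘L ContinuousLinearMap.inr ℝ V E) (κ p.2) :=
        HasFDerivAt.comp (κ p.2) ((hFd _ hp).differentiableAt (by simp)).hasFDerivAt
          (hasFDerivAt_prodMk_right p.1 (κ p.2))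
      have h2 := HasMFDerivAt.comp p.2 h1.hasMFDerivAt
        ((mdifferentiable_chartAt m₀).mdifferentiableAt hps).hasMFDerivAt
      have h3 := HasMFDerivAt.comp p.2
        ((mdifferentiable_chartAt m₀).mdifferentiableAt_symm (hFt _ hp)).hasMFDerivAt h2
      have h4 := congrArg (fun A => A (Z Y p.2)) h3.mfderiv
      refine h4.trans ?_
      have h5 : fderiv ℝ F (p.1, κ p.2) (0, mfderiv 𝓘(ℝ, E) 𝓘(ℝ, E) κ p.2 (Z Y p.2)) =
          chartFamily Z m₀ (F (p.1, κ p.2)) (exp (-b p.1) Y) := by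
        have h6 := mfderiv_chartAt_family (Z := Z) hps Y
        exact (congrArg (fun v : E => fderiv ℝ F (p.1, κ p.2) (0, v)) h6).trans (hFY _ hp Y)
      refine Eq.trans ?_ (mfderiv_chartAt_symm_family (hFt _ hp) (exp (-b p.1) Y))
      exact congrArg (mfderiv 𝓘(ℝ, E) 𝓘(ℝ, E) κ.symm (F (p.1, κ p.2))) h5
  · show κ.symm (F (0, κ m₀)) = m₀
    rw [hF0, κ.left_inv hmκ]
  · let B : E →L[ℝ] E := mfderiv 𝓘(ℝ, E) 𝓘(ℝ, E) κ.symm (κ m₀)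
    have hB : HasMFDerivAt 𝓘(ℝ, E) 𝓘(ℝ, E) κ.symm (F (0, κ m₀)) B := by
      rw [hF0]
      exact ((mdifferentiable_chartAt m₀).mdifferentiableAt_symm hκm).hasMFDerivAt
    refine ⟨B ∘L chartFamily Z m₀ (κ m₀), fun Y => ?_, HasMFDerivAt.comp (0 : V) hB hA.hasMFDerivAt⟩
    have h1 : B (chartFamily Z m₀ (κ m₀) Y) = Z Y (κ.symm (κ m₀)) :=
      mfderiv_chartAt_symm_family hκm Y
    have h2 := congrArg (fun m => (Z Y m : E)) (κ.left_inv hmκ)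
    exact h1.trans h2
  · exact ContMDiffAt.comp m₀ hτ.contMDiffAt (contMDiffAt_chartAt hmκ)
  · filter_upwards [(κ.continuousAt hmκ).eventually hτr, κ.open_source.mem_nhds hmκ] with m hm hms
    show κ.symm (F (τ (κ m), κ m₀)) = m
    rw [hm, κ.left_inv hms]

end ManifoldFlow

/-! ### The adjoint action of a composition of flows. -/

section AdjointAction

open NormedSpace

variable {V : Type*} [NormedAddCommGroup V] [NormedSpace ℝ V]

/-- The adjoint action of a composition of flows. -/
def listAd (b : V →L[ℝ] V →L[ℝ] V) : List (V × ℝ) → V →L[ℝ] V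
  | [] => 1
  | p :: L => listAd b L * exp (-b (p.2 • p.1))

lemma listAd_append (b : V →L[ℝ] V →L[ℝ] V) (L L' : List (V × ℝ)) :
    listAd b (L ++ L') = listAd b L' * listAd b L := by
  induction L with
  | nil => simp [listAd]
  | cons p L ih => simp [listAd, ih, mul_assoc]

lemma mul_apply_clm (C D : V →L[ℝ] V) (v : V) : (C * D) v = C (D v) := rfl

variable [CompleteSpace V]

lemma exp_add_clm {C D : V →L[ℝ] V} (h : Commute C D) : exp (C + D) = exp C * exp D := by
  let _ : NormedAlgebra ℚ (V →L[ℝ] V) := NormedAlgebra.restrictScalars ℚ ℝ _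
  exact exp_add_of_commute h

lemma exp_mul_exp_neg_clm (D : V →L[ℝ] V) : exp D * exp (-D) = 1 := by
  rw [← exp_add_clm (Commute.refl D).neg_right, add_neg_cancel, exp_zero]

lemma exp_neg_mul_exp_clm (D : V →L[ℝ] V) : exp (-D) * exp D = 1 := by
  rw [← exp_add_clm (Commute.refl D).neg_left, neg_add_cancel, exp_zero]

/-- For a derivation `D`, the curve `exp (-tD) (b (exp (tD) Y) (exp (tD) W))` has zero derivative;
its values at `0` and `1` are compared. -/
lemma exp_derivation_apply {b : V →L[ℝ] V →L[ℝ] V} {D : V →L[ℝ] V}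
    (hD : ∀ Y W, D (b Y W) = b (D Y) W + b Y (D W)) (Y W : V) :
    (exp D : V →L[ℝ] V) (b Y W) = b ((exp D : V →L[ℝ] V) Y) ((exp D : V →L[ℝ] V) W) := by
  have hd : ∀ t : ℝ, HasDerivAt
      (fun t : ℝ => (exp (t • -D) : V →L[ℝ] V) (b ((exp (t • D) : V →L[ℝ] V) Y) ((exp (t • D) : V →L[ℝ] V) W))) 0 t := by
    intro t
    have h1 := (b.hasFDerivAt.comp_hasDerivAt t (hasDerivAt_exp_smul_apply D Y t)).clm_apply
      (hasDerivAt_exp_smul_apply D W t)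
    have h2 := (hasDerivAt_exp_smul_const (𝕂 := ℝ) (-D) t).clm_apply h1
    refine h2.congr_deriv ?_
    simp only [mul_apply_clm, Function.comp_apply]
    rw [← map_add, ← hD, ← map_zero (exp (t • -D) : V →L[ℝ] V)]
    exact congrArg _ (neg_add_cancel (D _))
  have := is_const_of_deriv_eq_zero (fun t => (hd t).differentiableAt) (fun t => (hd t).deriv) 1 0
  simp only [one_smul, zero_smul, exp_zero] at this
  have h3 := congrArg (exp D : V →L[ℝ] V) this
  rw [← mul_apply_clm, exp_mul_exp_neg_clm] at h3
  simpa using h3.symm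

lemma listAd_bracket {b : V →L[ℝ] V →L[ℝ] V}
    (hb : ∀ X Y W, b X (b Y W) = b (b X Y) W + b Y (b X W)) (L : List (V × ℝ)) (Y W : V) :
    listAd b L (b Y W) = b (listAd b L Y) (listAd b L W) := by
  induction L generalizing Y W with
  | nil => rfl
  | cons p L ih =>
    have h := exp_derivation_apply (b := b) (D := -b (p.2 • p.1)) (fun Y W => by
      rw [← map_neg]; exact hb _ _ _) Y W
    simp only [listAd, mul_apply_clm, h, ih]

lemma listAd_bijective (b : V →L[ℝ] V →L[ℝ] V) (L : List (V × ℝ)) :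
    Function.Bijective (listAd b L) := by
  induction L with
  | nil => exact Function.bijective_id
  | cons p L ih =>
    have h : Function.Bijective (exp (-b (p.2 • p.1)) : V →L[ℝ] V) := by
      refine Function.bijective_iff_has_inverse.2 ⟨(exp (b (p.2 • p.1)) : V →L[ℝ] V), fun v => ?_, fun v => ?_⟩
      · exact congrArg (fun A : V →L[ℝ] V => A v) (exp_mul_exp_neg_clm _)
      · exact congrArg (fun A : V →L[ℝ] V => A v) (exp_neg_mul_exp_clm _)
    exact ih.comp h

end AdjointAction

/-! ### Flows for arbitrary times as germs of intertwining maps. -/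

section FlowGerms

open Set VectorField NormedSpace

variable {V : Type*} [NormedAddCommGroup V] [NormedSpace ℝ V] [FiniteDimensional ℝ V]
  {E : Type*} [NormedAddCommGroup E] [NormedSpace ℝ E] [FiniteDimensional ℝ E]
  {M : Type*} [TopologicalSpace M] [ChartedSpace E M] [IsManifold 𝓘(ℝ, E) ∞ M]
  {b : V →L[ℝ] V →L[ℝ] V} {Z : V →ₗ[ℝ] ∀ x : M, TangentSpace 𝓘(ℝ, E) x}

/-- Compositions of local flows of the fields in the family `Z`. -/
def FlowsAlongList (Z : V →ₗ[ℝ] ∀ x : M, TangentSpace 𝓘(ℝ, E) x) : List (V × ℝ) → M → M → Prop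
  | [], y, z => y = z
  | p :: L, y, z => ∃ w : M, FlowsAlong (Z p.1) p.2 y w ∧ FlowsAlongList Z L w z

lemma FlowsAlongList.append {L L' : List (V × ℝ)} {x y z : M} (h : FlowsAlongList Z L x y)
    (h' : FlowsAlongList Z L' y z) : FlowsAlongList Z (L ++ L') x z := by
  induction L generalizing x with
  | nil => exact (show x = y from h) ▸ h'
  | cons p L ih =>
    obtain ⟨w, h1, h2⟩ := h
    exact ⟨w, h1, ih h2⟩

/-- Near `q`, the map `φ` is smooth and intertwines the family `Z` by means of `A`. -/
structure IntertwinesAt (Z : V →ₗ[ℝ] ∀ x : M, TangentSpace 𝓘(ℝ, E) x) (A : V →L[ℝ] V) (φ : M → M)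
    (q : M) : Prop where
  smooth : ContMDiffAt 𝓘(ℝ, E) 𝓘(ℝ, E) ∞ φ q
  mfderiv_apply : ∀ Y, mfderiv 𝓘(ℝ, E) 𝓘(ℝ, E) φ q (Z Y q) = Z (A Y) (φ q)

lemma IntertwinesAt.comp {A B : V →L[ℝ] V} {φ ψ : M → M} {q : M}
    (hψ : IntertwinesAt Z B ψ (φ q)) (hφ : IntertwinesAt Z A φ q) :
    IntertwinesAt Z (B * A) (ψ ∘ φ) q := by
  refine ⟨hψ.smooth.comp q hφ.smooth, fun Y => ?_⟩
  rw [mfderiv_comp q (hψ.smooth.mdifferentiableAt (by simp)) (hφ.smooth.mdifferentiableAt (by simp))]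
  exact (congrArg (mfderiv 𝓘(ℝ, E) 𝓘(ℝ, E) ψ (φ q)) (hφ.mfderiv_apply Y)).trans
    (hψ.mfderiv_apply (A Y))

lemma intertwinesAt_id (q : M) : IntertwinesAt Z 1 id q :=
  ⟨contMDiffAt_id, fun Y => by rw [mfderiv_id]; rfl⟩

/-- `F` realizes the time one flows near `p = (X, m)`. -/
def IsFlowAt (b : V →L[ℝ] V →L[ℝ] V) (Z : V →ₗ[ℝ] ∀ x : M, TangentSpace 𝓘(ℝ, E) x)
    (F : V → M → M) (p : V × M) : Prop :=
  FlowsAlong (Z p.1) 1 p.2 (F p.1 p.2) ∧ IntertwinesAt Z (exp (-b p.1)) (F p.1) p.2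

lemma integralCurve_flowsAlong {X : V} {c : ℝ → M}
    (hc : IsMIntegralCurveOn (I := 𝓘(ℝ, E)) c (Z X) (Icc 0 1)) {s s' : ℝ} (hs : s ∈ Icc (0 : ℝ) 1)
    (hs' : s' ∈ Icc (0 : ℝ) 1) : FlowsAlong (Z ((s' - s) • X)) 1 (c s) (c s') := by
  refine ⟨(c ∘ (· + s)) ∘ (· * (s' - s)), ?_, by simp, by simp⟩
  rw [map_smul]
  refine ((hc.comp_add s).comp_mul (s' - s)).mono fun t ht => ?_
  rw [uIcc_of_le zero_le_one] at ht
  show t * (s' - s) + s ∈ Icc (0 : ℝ) 1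
  have h1 := ht.1
  have h2 := ht.2
  constructor
  · nlinarith [mul_nonneg h1 hs'.1, mul_nonneg (sub_nonneg.2 h2) hs.1]
  · nlinarith [mul_nonneg h1 (sub_nonneg.2 hs'.2), mul_nonneg (sub_nonneg.2 h2) (sub_nonneg.2 hs.2)]

/-- Wherever the time `t` flow of `Z X` is defined, it is given by a smooth intertwining map. -/
theorem FlowsAlong.exists_intertwining [T2Space M] (hZ : IsTransitiveFamily b Z) {X : V} {t : ℝ}
    {x y : M} (h : FlowsAlong (Z X) t x y) :
    ∃ φ : M → M, φ x = y ∧ ∀ᶠ q in 𝓝 x, IntertwinesAt Z (exp (-b (t • X))) φ q ∧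
      ∀ z, FlowsAlong (Z X) t q z → z = φ q := by
  have := FiniteDimensional.complete ℝ V
  suffices H : ∀ (X : V) (x y : M), FlowsAlong (Z X) 1 x y →
      ∃ φ : M → M, φ x = y ∧ ∀ᶠ q in 𝓝 x, IntertwinesAt Z (exp (-b X)) φ q ∧
      ∀ z, FlowsAlong (Z X) 1 q z → z = φ q by
    obtain ⟨φ, hφ, h1⟩ := H (t • X) x y (by rw [map_smul]; exact h.time_one)
    exact ⟨φ, hφ, h1.mono fun q hq =>
      ⟨hq.1, fun z hz => hq.2 z (by rw [map_smul]; exact hz.time_one)⟩⟩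
  clear h
  rintro X x y ⟨c, hc, rfl, rfl⟩
  rw [uIcc_of_le zero_le_one] at hc
  -- `S s`: the time `s` flow is given near `c 0` by an intertwining map. The uniqueness clause
  -- concerns integral curves on all of `[0, 1]`, so that one class of curves serves every `s`.
  let S : ℝ → Prop := fun s => ∃ φ : M → M, φ (c 0) = c s ∧ ∀ᶠ q in 𝓝 (c 0),
    IntertwinesAt Z (exp (-b (s • X))) φ q ∧
    ∀ c' : ℝ → M, IsMIntegralCurveOn (I := 𝓘(ℝ, E)) c' (Z X) (Icc 0 1) → c' 0 = q → c' s = φ q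
  -- Composition with the flow of `(s' - s) • X` near `c s` passes from `s` to `s'`; the case `s' <
  -- s` is included.
  have hstep : ∀ (F : V → M → M) (s s' : ℝ), s ∈ Icc (0 : ℝ) 1 → s' ∈ Icc (0 : ℝ) 1 →
      (∀ᶠ p in 𝓝 ((s' - s) • X, c s), IsFlowAt b Z F p) → S s → S s' := by
    rintro F s s' hs hs' hF ⟨φ, hφ, hev⟩
    refine ⟨F ((s' - s) • X) ∘ φ, ?_, ?_⟩
    · rw [Function.comp_apply, hφ]
      exact hF.self_of_nhds.1.unique hZ (integralCurve_flowsAlong hc hs hs')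
    · have hcont : Filter.Tendsto φ (𝓝 (c 0)) (𝓝 (c s)) :=
        hφ ▸ hev.self_of_nhds.1.smooth.continuousAt
      have hF' := hcont.eventually
        (show ∀ᶠ m in 𝓝 (c s), IsFlowAt b Z F ((s' - s) • X, m) from
          (Continuous.prodMk_right ((s' - s) • X)).continuousAt.eventually hF)
      filter_upwards [hev, hF'] with q hq hFq
      refine ⟨?_, fun c' hc' hc'0 => ?_⟩
      · have h1 := hFq.2.comp hq.1
        have h2 : exp (-b ((s' - s) • X)) * exp (-b (s • X)) = exp (-b (s' • X)) := by
          rw [← exp_add_clm]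
          · congr 1
            rw [← neg_add, ← map_add, ← add_smul, sub_add_cancel]
          · simp only [map_smul]
            exact (((Commute.refl (b X)).smul_left _).smul_right _).neg_left.neg_right
        exact h2 ▸ h1
      · have h1 := integralCurve_flowsAlong hc' hs hs'
        rw [hq.2 c' hc' hc'0] at h1
        exact h1.unique hZ hFq.1
  have h0 : S 0 := by
    refine ⟨id, rfl, Filter.Eventually.of_forall fun q => ⟨?_, fun c' _ h => h⟩⟩
    rw [zero_smul, map_zero, neg_zero, exp_zero]
    exact intertwinesAt_id q
  -- Flow families are only local, but the one around `c s₀` links `S s₀` and `S s` in both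
  -- directions for `s` near `s₀`. Connectedness of `[0, 1]` chains these implications.
  have hP := (isPreconnected_Icc (a := (0 : ℝ)) (b := 1)).induction₂' (fun s s' => S s → S s')
    (fun s₀ hs₀ => by
      obtain ⟨F, τ, hF, -⟩ := exists_flow_family hZ (c s₀)
      have hF' : ∀ᶠ p in 𝓝 ((0 : V), c s₀), ∀ᶠ p' in 𝓝 p, IsFlowAt b Z F p' :=
        eventually_eventually_nhds.2 (hF.mono fun p hp => ⟨hp.1, hp.2.1, hp.2.2⟩)
      have hcc : Filter.Tendsto c (𝓝[Icc 0 1] s₀) (𝓝 (c s₀)) := hc.continuousOn s₀ hs₀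
      have t1 : Filter.Tendsto (fun s => ((s - s₀) • X, c s₀)) (𝓝[Icc 0 1] s₀)
          (𝓝 ((0 : V), c s₀)) := by
        have : Filter.Tendsto (fun s : ℝ => (s - s₀) • X) (𝓝 s₀) (𝓝 0) := by
          simpa using (by fun_prop : Continuous fun s : ℝ => (s - s₀) • X).tendsto s₀
        exact (this.mono_left nhdsWithin_le_nhds).prodMk_nhds tendsto_const_nhds
      have t2 : Filter.Tendsto (fun s => ((s₀ - s) • X, c s)) (𝓝[Icc 0 1] s₀)
          (𝓝 ((0 : V), c s₀)) := by
        have : Filter.Tendsto (fun s : ℝ => (s₀ - s) • X) (𝓝 s₀) (𝓝 0) := by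
          simpa using (by fun_prop : Continuous fun s : ℝ => (s₀ - s) • X).tendsto s₀
        exact (this.mono_left nhdsWithin_le_nhds).prodMk_nhds hcc
      filter_upwards [t1.eventually hF', t2.eventually hF', self_mem_nhdsWithin] with s h1 h2 hs
      exact ⟨hstep F s₀ s hs₀ hs h1, hstep F s s₀ hs hs₀ h2⟩)
    (fun _ _ _ _ _ _ h1 h2 h => h2 (h1 h)) (x := 0) (y := 1) (by simp) (by simp)
  obtain ⟨φ, hφ, hev⟩ := hP h0
  refine ⟨φ, hφ, hev.mono fun q hq => ⟨by simpa using hq.1, ?_⟩⟩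
  rintro z ⟨c', hc', h0', rfl⟩
  rw [uIcc_of_le zero_le_one] at hc'
  exact hq.2 c' hc' h0'

/-- Wherever a composition of flows is defined, it is given by a smooth intertwining map. -/
theorem FlowsAlongList.exists_intertwining [T2Space M] (hZ : IsTransitiveFamily b Z)
    {L : List (V × ℝ)} {x y : M} (h : FlowsAlongList Z L x y) :
    ∃ φ : M → M, φ x = y ∧ ∀ᶠ q in 𝓝 x, IntertwinesAt Z (listAd b L) φ q ∧
      ∀ z, FlowsAlongList Z L q z → z = φ q := by
  induction L generalizing x with
  | nil =>
    exact ⟨id, h, Filter.Eventually.of_forall fun q =>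
      ⟨intertwinesAt_id q, fun z hz => Eq.symm hz⟩⟩
  | cons p L ih =>
    obtain ⟨w, h1, h2⟩ := h
    obtain ⟨φ, rfl, hφ⟩ := h1.exists_intertwining hZ
    obtain ⟨ψ, hψ, hψ'⟩ := ih h2
    refine ⟨ψ ∘ φ, hψ, ?_⟩
    filter_upwards [hφ, hφ.self_of_nhds.1.smooth.continuousAt.eventually hψ'] with q hq hq'
    refine ⟨hq'.1.comp hq.1, ?_⟩
    rintro z ⟨w, hw, hz⟩
    rw [hq.2 w hw] at hz
    exact hq'.2 z hz

end FlowGerms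

/-! ### Transport between points along invertible germs of flows. -/

section Transport

open Set VectorField NormedSpace

variable {V : Type*} [NormedAddCommGroup V] [NormedSpace ℝ V] [FiniteDimensional ℝ V]
  {E : Type*} [NormedAddCommGroup E] [NormedSpace ℝ E] [FiniteDimensional ℝ E]
  {M : Type*} [TopologicalSpace M] [ChartedSpace E M] [IsManifold 𝓘(ℝ, E) ∞ M]
  {b : V →L[ℝ] V →L[ℝ] V} {Z : V →ₗ[ℝ] ∀ x : M, TangentSpace 𝓘(ℝ, E) x}

/-- Near `x`, the map `φ` is the composition of the flows listed in `L`, and `φ x = y`. -/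
structure IsFlowGerm (b : V →L[ℝ] V →L[ℝ] V) (Z : V →ₗ[ℝ] ∀ x : M, TangentSpace 𝓘(ℝ, E) x)
    (L : List (V × ℝ)) (φ : M → M) (x y : M) : Prop where
  apply_eq : φ x = y
  eventually : ∀ᶠ q in 𝓝 x, IntertwinesAt Z (listAd b L) φ q ∧ FlowsAlongList Z L q (φ q)

lemma IsFlowGerm.tendsto {L : List (V × ℝ)} {φ : M → M} {x y : M} (h : IsFlowGerm b Z L φ x y) :
    Filter.Tendsto φ (𝓝 x) (𝓝 y) :=
  h.apply_eq ▸ h.eventually.self_of_nhds.1.smooth.continuousAt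

lemma IsFlowGerm.comp {L L' : List (V × ℝ)} {φ φ' : M → M} {x y z : M}
    (h : IsFlowGerm b Z L φ x y) (h' : IsFlowGerm b Z L' φ' y z) :
    IsFlowGerm b Z (L ++ L') (φ' ∘ φ) x z := by
  refine ⟨by rw [Function.comp_apply, h.apply_eq, h'.apply_eq], ?_⟩
  filter_upwards [h.eventually, h.tendsto.eventually h'.eventually] with q hq hq'
  rw [listAd_append]
  exact ⟨hq'.1.comp hq.1, hq.2.append hq'.2⟩

/-- A germ of a composition of flows leads from `x` to `y` and has an inverse of the same kind;
the adjoint actions of the two germs are `A` and `A'`. -/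
def Transport (b : V →L[ℝ] V →L[ℝ] V) (Z : V →ₗ[ℝ] ∀ x : M, TangentSpace 𝓘(ℝ, E) x)
    (x y : M) (A A' : V →L[ℝ] V) : Prop :=
  ∃ (L L' : List (V × ℝ)) (φ ψ : M → M), IsFlowGerm b Z L φ x y ∧ IsFlowGerm b Z L' ψ y x ∧
    (∀ᶠ q in 𝓝 x, ψ (φ q) = q) ∧ (∀ᶠ q in 𝓝 y, φ (ψ q) = q) ∧
    A = listAd b L ∧ A' = listAd b L' ∧ A' * A = 1 ∧ A * A' = 1

lemma Transport.symm {x y : M} {A A' : V →L[ℝ] V} (h : Transport b Z x y A A') :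
    Transport b Z y x A' A := by
  obtain ⟨L, L', φ, ψ, h1, h2, h3, h4, h5, h6, h7, h8⟩ := h
  exact ⟨L', L, ψ, φ, h2, h1, h4, h3, h6, h5, h8, h7⟩

lemma Transport.trans {x y z : M} {A A' B B' : V →L[ℝ] V} (h : Transport b Z x y A A')
    (h' : Transport b Z y z B B') : Transport b Z x z (B * A) (A' * B') := by
  obtain ⟨L, L', φ, ψ, h1, h2, h3, h4, rfl, rfl, h7, h8⟩ := h
  obtain ⟨K, K', α, β, k1, k2, k3, k4, rfl, rfl, k7, k8⟩ := h'
  refine ⟨L ++ K, K' ++ L', α ∘ φ, ψ ∘ β, h1.comp k1, k2.comp h2, ?_, ?_, (listAd_append _ _ _).symm,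
    (listAd_append _ _ _).symm, ?_, ?_⟩
  · filter_upwards [h3, h1.tendsto.eventually k3] with q hq hq'
    simp only [Function.comp_apply, hq', hq]
  · filter_upwards [k4, k2.tendsto.eventually h4] with q hq hq'
    simp only [Function.comp_apply, hq', hq]
  · rw [mul_assoc, ← mul_assoc _ (listAd b K), k7, one_mul, h7]
  · rw [mul_assoc, ← mul_assoc (listAd b L), h8, one_mul, k8]

variable [T2Space M]

/-- A neighbourhood of `m₀` is reached by transports along flows for small times. -/
theorem exists_transport_family (hZ : IsTransitiveFamily b Z) (m₀ : M) :
    ∃ (F : V → M) (τ : M → V),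
      (∀ᶠ X in 𝓝 0, Transport b Z m₀ (F X) (exp (-b X)) (exp (b X))) ∧ F 0 = m₀ ∧
      (∃ A : V →L[ℝ] TangentSpace 𝓘(ℝ, E) m₀, (∀ Y, A Y = Z Y m₀) ∧
        HasMFDerivAt 𝓘(ℝ, V) 𝓘(ℝ, E) F 0 A) ∧
      ContMDiffAt 𝓘(ℝ, E) 𝓘(ℝ, V) ∞ τ m₀ ∧ τ m₀ = 0 ∧ ∀ᶠ m in 𝓝 m₀, F (τ m) = m := by
  have := FiniteDimensional.complete ℝ V
  obtain ⟨F, τ, hF, hF0, ⟨D, hD, hFD⟩, hτ, hτ0, hFτ⟩ := exists_flow_family hZ m₀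
  refine ⟨fun X => F X m₀, τ, ?_, hF0, ⟨D, hD, hFD⟩, hτ, hτ0, hFτ⟩
  have hF2 : ∀ᶠ p in 𝓝 ((0 : V), m₀), ∀ᶠ q in 𝓝 p.2, IsFlowAt b Z F (p.1, q) := by
    refine (eventually_eventually_nhds.2 (hF.mono fun p hp =>
      (⟨hp.1, hp.2.1, hp.2.2⟩ : IsFlowAt b Z F p))).mono fun p hp => ?_
    exact (Continuous.prodMk_right p.1).continuousAt.eventually hp
  have t1 : Filter.Tendsto (fun X : V => (X, m₀)) (𝓝 0) (𝓝 (0, m₀)) :=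
    Filter.tendsto_id.prodMk_nhds tendsto_const_nhds
  -- For small `X` the flow of `-X` is available near `F X m₀`; by reversal of curves and uniqueness
  -- it is inverse to the flow of `X`.
  have t2 : Filter.Tendsto (fun X : V => (-X, F X m₀)) (𝓝 0) (𝓝 (0, m₀)) := by
    have h1 : Filter.Tendsto (fun X : V => -X) (𝓝 0) (𝓝 0) := by
      simpa using (continuous_neg (G := V)).tendsto 0
    have h2 : Filter.Tendsto (fun X => F X m₀) (𝓝 0) (𝓝 (F 0 m₀)) := hFD.1
    rw [hF0] at h2
    exact h1.prodMk_nhds h2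
  have hgerm : ∀ X m, (∀ᶠ q in 𝓝 m, IsFlowAt b Z F (X, q)) →
      IsFlowGerm b Z [(X, 1)] (F X) m (F X m) := fun X m h => by
    refine ⟨rfl, h.mono fun q hq => ⟨?_, F X q, hq.1, rfl⟩⟩
    have : listAd b [(X, (1 : ℝ))] = exp (-b X) := by simp [listAd]
    exact this ▸ hq.2
  have hinv : ∀ X m m', m' = F X m → (∀ᶠ q in 𝓝 m, IsFlowAt b Z F (X, q)) →
      (∀ᶠ q in 𝓝 m', IsFlowAt b Z F (-X, q)) → ∀ᶠ q in 𝓝 m, F (-X) (F X q) = q := by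
    rintro X m _ rfl h h'
    filter_upwards [h, (hgerm X m h).tendsto.eventually h'] with q hq hq'
    have h1 := hq.1.reverse
    rw [← map_neg] at h1
    exact hq'.1.unique hZ h1
  filter_upwards [t1.eventually hF2, t2.eventually hF2] with X h1 h2
  have h3 := hinv X m₀ _ rfl h1 h2
  have h4 := hinv (-X) (F X m₀) m₀ h3.self_of_nhds.symm h2 (by rwa [neg_neg])
  rw [neg_neg] at h4
  refine ⟨[(X, 1)], [(-X, 1)], F X, F (-X), hgerm X m₀ h1, ?_, h3, h4, by simp [listAd],
    by simp [listAd], exp_mul_exp_neg_clm _, exp_neg_mul_exp_clm _⟩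
  have := hgerm (-X) (F X m₀) h2
  rwa [h3.self_of_nhds] at this

lemma eventually_exists_transport (hZ : IsTransitiveFamily b Z) (m₀ : M) :
    ∀ᶠ m in 𝓝 m₀, ∃ A A', Transport b Z m₀ m A A' := by
  obtain ⟨F, τ, hF, -, -, hτ, hτ0, hFτ⟩ := exists_transport_family hZ m₀
  have h1 : Filter.Tendsto τ (𝓝 m₀) (𝓝 0) := hτ0 ▸ hτ.continuousAt
  filter_upwards [h1.eventually hF, hFτ] with m hm hm'
  rw [hm'] at hm
  exact ⟨_, _, hm⟩

/-- Being joined by a transport is symmetric and transitive and relates each point to all points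
near it, so connectedness of `M` relates any two points. -/
theorem exists_transport [PreconnectedSpace M] (hZ : IsTransitiveFamily b Z) (x y : M) :
    ∃ A A', Transport b Z x y A A' := by
  have h1 : Std.Symm fun x y => ∃ A A', Transport b Z x y A A' :=
    ⟨fun x y ⟨A, A', h⟩ => ⟨_, _, h.symm⟩⟩
  have h2 : IsTrans M fun x y => ∃ A A', Transport b Z x y A A' :=
    ⟨fun x y z ⟨A, A', h⟩ ⟨B, B', h'⟩ => ⟨_, _, h.trans h'⟩⟩
  exact PreconnectedSpace.induction₂ _ (eventually_exists_transport hZ) h2 x y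

end Transport

/-! ### A fundamental field is determined by its germ. -/

section LocalKernel

open Set VectorField NormedSpace

variable {V : Type*} [NormedAddCommGroup V] [NormedSpace ℝ V] [FiniteDimensional ℝ V]
  {E : Type*} [NormedAddCommGroup E] [NormedSpace ℝ E] [FiniteDimensional ℝ E]
  {M : Type*} [TopologicalSpace M] [ChartedSpace E M] [IsManifold 𝓘(ℝ, E) ∞ M]
  {b : V →L[ℝ] V →L[ℝ] V} {Z : V →ₗ[ℝ] ∀ x : M, TangentSpace 𝓘(ℝ, E) x}

/-- The subspace of all `X` for which the field `Z X` vanishes near `x`. -/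
def localKer (Z : V →ₗ[ℝ] ∀ x : M, TangentSpace 𝓘(ℝ, E) x) (x : M) : Submodule ℝ V where
  carrier := {X | ∀ᶠ y in 𝓝 x, Z X y = 0}
  zero_mem' := Filter.Eventually.of_forall fun y => by rw [map_zero]; rfl
  add_mem' := fun {X Y} hX hY => by
    filter_upwards [show ∀ᶠ y in 𝓝 x, Z X y = 0 from hX, show ∀ᶠ y in 𝓝 x, Z Y y = 0 from hY]
      with y h1 h2
    rw [map_add, Pi.add_apply, h1, h2]
    exact add_zero (0 : E)
  smul_mem' := fun a X hX => (show ∀ᶠ y in 𝓝 x, Z X y = 0 from hX).mono fun y h => by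
    rw [map_smul, Pi.smul_apply, h]
    exact smul_zero (A := E) a

/-- A finite basis of the space at `x` vanishes on a common neighbourhood of `x`. -/
lemma eventually_localKer_le (x : M) : ∀ᶠ y in 𝓝 x, localKer Z x ≤ localKer Z y := by
  let B := Module.finBasis ℝ (localKer Z x)
  have h : ∀ᶠ y in 𝓝 x, ∀ i, ∀ᶠ z in 𝓝 y, Z (B i : V) z = 0 :=
    Filter.eventually_all.2 fun i => eventually_eventually_nhds.2 (B i).2
  filter_upwards [h] with y hy X hX
  have h1 := B.sum_repr ⟨X, hX⟩
  have h2 : X = ∑ i, B.repr ⟨X, hX⟩ i • (B i : V) := by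
    have := congrArg (Submodule.subtype _) h1
    rw [map_sum] at this
    exact this.symm
  rw [h2]
  exact Submodule.sum_mem _ fun i _ => Submodule.smul_mem _ _ (hy i)

lemma Transport.mem_localKer {x y : M} {A A' : V →L[ℝ] V} (h : Transport b Z x y A A') {X : V}
    (hX : X ∈ localKer Z x) : A X ∈ localKer Z y := by
  obtain ⟨L, L', φ, ψ, h1, h2, h3, h4, rfl, rfl, -, -⟩ := h
  show ∀ᶠ q in 𝓝 y, Z (listAd b L X) q = 0
  filter_upwards [h4, h2.tendsto.eventually h1.eventually, h2.tendsto.eventually hX]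
    with q hq hφ hXq
  have := hφ.1.mfderiv_apply X
  rw [hXq, map_zero, hq] at this
  exact this.symm

lemma Transport.finrank_localKer_le {x y : M} {A A' : V →L[ℝ] V} (h : Transport b Z x y A A') :
    Module.finrank ℝ (localKer Z x) ≤ Module.finrank ℝ (localKer Z y) := by
  have hinv : A' * A = 1 := by
    obtain ⟨-, -, -, -, -, -, -, -, -, -, h7, -⟩ := h
    exact h7
  refine LinearMap.finrank_le_finrank_of_injective
    (f := (A : V →ₗ[ℝ] V).restrict fun X hX => h.mem_localKer hX) fun X Y hXY => ?_
  have h1 : A X = A Y := congrArg Subtype.val hXY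
  have h2 := congrArg A' h1
  rw [← mul_apply_clm, ← mul_apply_clm, hinv] at h2
  exact Subtype.ext h2

variable [T2Space M] [PreconnectedSpace M]

/-- The space at `x` is contained in the space at nearby points, and transport makes the dimensions
equal. Hence the space is locally constant, and constant by connectedness. -/
lemma localKer_eq (hZ : IsTransitiveFamily b Z) (x y : M) : localKer Z x = localKer Z y := by
  have h : ∀ x : M, ∀ᶠ y in 𝓝 x, localKer Z x = localKer Z y := fun x => by
    filter_upwards [eventually_localKer_le (Z := Z) x, eventually_exists_transport hZ x]
      with y hy ⟨A, A', hA⟩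
    exact Submodule.eq_of_le_of_finrank_le hy hA.symm.finrank_localKer_le
  have h1 : Std.Symm fun x y : M => localKer Z x = localKer Z y := ⟨fun x y h => h.symm⟩
  have h2 : IsTrans M fun x y => localKer Z x = localKer Z y := ⟨fun x y z h h' => h.trans h'⟩
  exact PreconnectedSpace.induction₂ _ h h2 x y

/-- For an effective transitive family, a field is determined by its germ at a point. -/
theorem eq_of_eventually_family_eq (hZ : IsTransitiveFamily b Z) (hinj : Function.Injective Z)
    {x : M} {X Y : V} (h : ∀ᶠ y in 𝓝 x, Z X y = Z Y y) : X = Y := by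
  have h1 : X - Y ∈ localKer Z x := h.mono fun y hy => by
    rw [map_sub, Pi.sub_apply, hy]
    exact sub_self (Z Y y : E)
  refine hinj (funext fun y => ?_)
  rw [localKer_eq hZ x y] at h1
  have h2 : Z (X - Y) y = 0 :=
    (show ∀ᶠ z in 𝓝 y, Z (X - Y) z = 0 from h1).self_of_nhds
  rw [map_sub, Pi.sub_apply] at h2
  exact sub_eq_zero.1 (h2 : (Z X y : E) - Z Y y = 0)

end LocalKernel

/-! ### Pullback of the family by an intertwining map. -/

section Pullback

open Set VectorField NormedSpace

variable {V : Type*} [NormedAddCommGroup V] [NormedSpace ℝ V] [FiniteDimensional ℝ V]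
  {E : Type*} [NormedAddCommGroup E] [NormedSpace ℝ E] [FiniteDimensional ℝ E]
  {M : Type*} [TopologicalSpace M] [ChartedSpace E M] [IsManifold 𝓘(ℝ, E) ∞ M]
  {b : V →L[ℝ] V →L[ℝ] V} {Z : V →ₗ[ℝ] ∀ x : M, TangentSpace 𝓘(ℝ, E) x}

/-- The tangent map is onto, because the fields span and `A` is onto. It is an endomorphism of the
finite dimensional `E`, hence invertible, so the inverse in the pullback is a true inverse and not
the default value. -/
lemma mpullback_eq_of_intertwinesAt (hZ : IsTransitiveFamily b Z) {A : V →L[ℝ] V}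
    (hA : Function.Surjective A) {φ : M → M} {q : M} (h : IntertwinesAt Z A φ q) (Y : V) :
    mpullback 𝓘(ℝ, E) 𝓘(ℝ, E) φ (Z (A Y)) q = Z Y q := by
  let D : E →L[ℝ] E := mfderiv 𝓘(ℝ, E) 𝓘(ℝ, E) φ q
  have hsurj : Function.Surjective D := fun v => by
    obtain ⟨X, rfl⟩ := hZ.surjective (φ q) v
    obtain ⟨Y, rfl⟩ := hA X
    exact ⟨Z Y q, h.mfderiv_apply Y⟩
  have hinj : Function.Injective D :=
    (LinearMap.injective_iff_surjective (f := (D : E →ₗ[ℝ] E))).2 hsurj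
  have := FiniteDimensional.complete ℝ E
  have hD : D.IsInvertible := ⟨ContinuousLinearEquiv.ofBijective D
    (LinearMap.ker_eq_bot.2 hinj) (LinearMap.range_eq_top.2 hsurj), rfl⟩
  have h1 : D.inverse (Z (A Y) (φ q)) = Z Y q := by
    have h2 : D (Z Y q) = Z (A Y) (φ q) := h.mfderiv_apply Y
    rw [← h2]
    exact congrArg (fun A : E →L[ℝ] E => A (Z Y q)) hD.inverse_comp_self
  exact h1

lemma mpullback_eventuallyEq {φ ψ : M → M} {x : M} (h : φ =ᶠ[𝓝 x] ψ)
    (v : ∀ x : M, TangentSpace 𝓘(ℝ, E) x) :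
    ∀ᶠ y in 𝓝 x, mpullback 𝓘(ℝ, E) 𝓘(ℝ, E) φ v y = mpullback 𝓘(ℝ, E) 𝓘(ℝ, E) ψ v y := by
  filter_upwards [eventually_eventually_nhds.2 h] with y hy
  have h1 : mfderiv 𝓘(ℝ, E) 𝓘(ℝ, E) φ y = mfderiv 𝓘(ℝ, E) 𝓘(ℝ, E) ψ y :=
    Filter.EventuallyEq.mfderiv_eq hy
  have h2 : φ y = ψ y := hy.self_of_nhds
  have h3 : (v (φ y) : E) = v (ψ y) := by rw [h2]
  show (ContinuousLinearMap.inverse (mfderiv 𝓘(ℝ, E) 𝓘(ℝ, E) φ y : E →L[ℝ] E)) (v (φ y) : E) =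
    (ContinuousLinearMap.inverse (mfderiv 𝓘(ℝ, E) 𝓘(ℝ, E) ψ y : E →L[ℝ] E)) (v (ψ y) : E)
  rw [h3]
  exact congrArg (fun A : E →L[ℝ] E => A.inverse (v (ψ y) : E)) h1

end Pullback

/-! ### Connection forms along flows: invariance and uniqueness. -/

section ConnectionForm

open Set VectorField NormedSpace

variable {V : Type*} [NormedAddCommGroup V] [NormedSpace ℝ V] [FiniteDimensional ℝ V]
  {E : Type*} [NormedAddCommGroup E] [NormedSpace ℝ E] [FiniteDimensional ℝ E]
  {M : Type*} [TopologicalSpace M] [ChartedSpace E M] [IsManifold 𝓘(ℝ, E) ∞ M]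
  {b : V →L[ℝ] V →L[ℝ] V} {Z : V →ₗ[ℝ] ∀ x : M, TangentSpace 𝓘(ℝ, E) x}

lemma hasDerivWithinAt_clm_of_apply {W : Type*} [NormedAddCommGroup W] [NormedSpace ℝ W]
    {g : ℝ → V →L[ℝ] W} {g' : V →L[ℝ] W} {s : Set ℝ} {t : ℝ}
    (h : ∀ Y, HasDerivWithinAt (fun t => g t Y) (g' Y) s t) : HasDerivWithinAt g g' s t := by
  let B := Module.finBasis ℝ V
  let co : ∀ i, V →L[ℝ] ℝ := fun i => LinearMap.toContinuousLinearMap (B.coord i)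
  have hsum : ∀ A : V →L[ℝ] W, A = ∑ i, ContinuousLinearMap.smulRightL ℝ V W (co i) (A (B i)) := by
    intro A
    refine ContinuousLinearMap.ext fun v => ?_
    rw [sum_apply]
    conv_lhs => rw [← B.sum_repr v, map_sum]
    exact Finset.sum_congr rfl fun i _ => map_smul A _ _
  rw [hsum g']
  have h2 : g = fun t => ∑ i, ContinuousLinearMap.smulRightL ℝ V W (co i) (g t (B i)) :=
    funext fun t => hsum (g t)
  rw [h2]
  refine HasDerivWithinAt.fun_sum fun i _ => ?_
  exact (ContinuousLinearMap.smulRightL ℝ V W (co i)).hasFDerivAt.comp_hasDerivWithinAt t (h (B i))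

/-- A connection form for the family `Z`, with values in the parameter space `V`. -/
structure IsConnectionForm (b : V →L[ℝ] V →L[ℝ] V)
    (Z : V →ₗ[ℝ] ∀ x : M, TangentSpace 𝓘(ℝ, E) x)
    (θ : ∀ x : M, TangentSpace 𝓘(ℝ, E) x →ₗ[ℝ] V) : Prop where
  smooth : ContMDiff 𝓘(ℝ, E).tangent 𝓘(ℝ, V) ∞
    (fun v : TangentBundle 𝓘(ℝ, E) M => θ v.proj v.2)
  equivariant : ∀ X, ∀ η : (∀ x : M, TangentSpace 𝓘(ℝ, E) x), IsSmoothField η → ∀ x,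
    (show V from mfderiv 𝓘(ℝ, E) 𝓘(ℝ, V) (fun y => θ y (η y)) x (Z X x))
      - θ x (mlieBracket 𝓘(ℝ, E) (Z X) η x) = -b X (θ x (η x))
  reproduces : ∀ x X, Z (θ x (Z X x)) x = Z X x

/-- The endomorphism `θ_x ∘ ζ_x` of the parameter space. -/
def formProj (Z : V →ₗ[ℝ] ∀ x : M, TangentSpace 𝓘(ℝ, E) x)
    (θ : ∀ x : M, TangentSpace 𝓘(ℝ, E) x →ₗ[ℝ] V) (x : M) : V →L[ℝ] V :=
  LinearMap.toContinuousLinearMap (θ x ∘ₗ (LinearMap.proj x).comp Z)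

variable {θ : ∀ x : M, TangentSpace 𝓘(ℝ, E) x →ₗ[ℝ] V}

/-- Equivariance is tested on the fields `Z Y`. Their brackets with `Z X` lie in the family again,
so it becomes a linear equation for `θ ∘ Z` alone. -/
lemma IsConnectionForm.hasDerivWithinAt (hZ : IsTransitiveFamily b Z)
    (hθ : IsConnectionForm b Z θ) {X : V} {c : ℝ → M} {s : Set ℝ} {t : ℝ}
    (hc : IsMIntegralCurveOn (I := 𝓘(ℝ, E)) c (Z X) s) (ht : t ∈ s) :
    HasDerivWithinAt (fun t => formProj Z θ (c t))
      (formProj Z θ (c t) * b X - b X * formProj Z θ (c t)) s t := by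
  refine hasDerivWithinAt_clm_of_apply fun Y => ?_
  have h1 : ContMDiff 𝓘(ℝ, E) 𝓘(ℝ, V) ∞ (fun y => θ y (Z Y y)) := hθ.smooth.comp (hZ.smooth Y)
  have h2 := HasMFDerivWithinAt.comp t
    (h1.mdifferentiable (by simp) (c t)).hasMFDerivAt.hasMFDerivWithinAt
    (hc t ht) (subset_preimage_image c s)
  have h3 := hθ.equivariant X (Z Y) (hZ.smooth Y) (c t)
  rw [← hZ.bracket] at h3
  have h4 : (mfderiv 𝓘(ℝ, E) 𝓘(ℝ, V) (fun y => θ y (Z Y y)) (c t) (Z X (c t)) : V) =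
      (formProj Z θ (c t) * b X - b X * formProj Z θ (c t)) Y :=
    (sub_eq_iff_eq_add.1 h3).trans (neg_add_eq_sub _ _)
  let D : ℝ →L[ℝ] V := (mfderiv 𝓘(ℝ, E) 𝓘(ℝ, V) (fun y => θ y (Z Y y)) (c t) : E →L[ℝ] V).comp
      ((1 : ℝ →L[ℝ] ℝ).smulRight (Z X (c t) : E))
  have h5 : HasFDerivWithinAt (fun t => formProj Z θ (c t) Y) D s t :=
    hasMFDerivWithinAt_iff_hasFDerivWithinAt.1 h2
  have h6 : D 1 = (formProj Z θ (c t) * b X - b X * formProj Z θ (c t)) Y := by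
    rw [← h4]
    show (mfderiv 𝓘(ℝ, E) 𝓘(ℝ, V) (fun y => θ y (Z Y y)) (c t)) ((1 : ℝ) • Z X (c t)) = _
    rw [one_smul]
  rw [← h6]
  exact hasFDerivWithinAt_iff_hasDerivWithinAt.1 h5

/-- The preceding equation says that `exp (t b X) * formProj * exp (-t b X)` is constant along the
curve. -/
lemma IsConnectionForm.formProj_flowsAlong (hZ : IsTransitiveFamily b Z)
    (hθ : IsConnectionForm b Z θ) {X : V} {x y : M} (h : FlowsAlong (Z X) 1 x y) :
    formProj Z θ y * exp (-b X) = exp (-b X) * formProj Z θ x := by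
  have := FiniteDimensional.complete ℝ V
  obtain ⟨c, hc, rfl, rfl⟩ := h
  rw [uIcc_of_le zero_le_one] at hc
  have hd : ∀ t ∈ Icc (0 : ℝ) 1, HasDerivWithinAt
      (fun t : ℝ => exp (t • b X) * (formProj Z θ (c t) * exp (t • -b X))) 0 (Icc 0 1) t := by
    intro t ht
    have h1 := (hθ.hasDerivWithinAt hZ hc ht).mul
      (hasDerivAt_exp_smul_const' (𝕂 := ℝ) (-b X) t).hasDerivWithinAt
    have h2 := (hasDerivAt_exp_smul_const (𝕂 := ℝ) (b X) t).hasDerivWithinAt.mul h1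
    refine h2.congr_deriv ?_
    rw [Pi.mul_apply]
    noncomm_ring
  have hconst := constant_of_has_deriv_right_zero (a := (0 : ℝ)) (b := 1)
    (fun t ht => (hd t ht).continuousWithinAt)
    (fun t ht => (hd t ⟨ht.1, ht.2.le⟩).mono_of_mem_nhdsWithin (Icc_mem_nhdsGE_of_mem ht))
    1 (by simp)
  simp only [one_smul, zero_smul, exp_zero, one_mul, mul_one] at hconst
  rw [← hconst, ← mul_assoc, exp_neg_mul_exp_clm, one_mul]

lemma IsConnectionForm.formProj_flowsAlongList (hZ : IsTransitiveFamily b Z)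
    (hθ : IsConnectionForm b Z θ) {L : List (V × ℝ)} {x y : M} (h : FlowsAlongList Z L x y) :
    formProj Z θ y * listAd b L = listAd b L * formProj Z θ x := by
  induction L generalizing x with
  | nil => rw [show x = y from h]; simp [listAd]
  | cons p L ih =>
    obtain ⟨w, h1, h2⟩ := h
    have h3 := hθ.formProj_flowsAlong hZ (X := p.2 • p.1) (by rw [map_smul]; exact h1.time_one)
    rw [listAd, ← mul_assoc, ih h2, mul_assoc, h3, mul_assoc]

lemma IsConnectionForm.apply_form (hZ : IsTransitiveFamily b Z) (hθ : IsConnectionForm b Z θ)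
    (x : M) (v : TangentSpace 𝓘(ℝ, E) x) : Z (θ x v) x = v := by
  obtain ⟨X, rfl⟩ := hZ.surjective x v
  exact hθ.reproduces x X

/-- For a loop at `x` the projection `formProj Z θ x` commutes with the adjoint action, which
therefore preserves its image, the range of `θ x`. -/
lemma IsConnectionForm.range_invariant (hZ : IsTransitiveFamily b Z)
    (hθ : IsConnectionForm b Z θ) {L : List (V × ℝ)} {x : M} (h : FlowsAlongList Z L x x) {Y : V}
    (hY : Y ∈ LinearMap.range (θ x)) : listAd b L Y ∈ LinearMap.range (θ x) := by
  obtain ⟨v, rfl⟩ := hY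
  refine ⟨Z (listAd b L (θ x v)) x, ?_⟩
  have h1 := congrArg (fun A : V →L[ℝ] V => A (θ x v)) (hθ.formProj_flowsAlongList hZ h)
  refine h1.trans ?_
  show listAd b L (θ x (Z (θ x v) x)) = _
  rw [hθ.apply_form hZ]

variable [T2Space M] [PreconnectedSpace M]

/-- `θ x` is a right inverse of evaluation at `x`, and evaluation is injective on its range; so the
range determines `θ x`. The values at all other points follow by transport from `x`. -/
lemma IsConnectionForm.eq_of_range_eq (hZ : IsTransitiveFamily b Z) (hθ : IsConnectionForm b Z θ)
    {θ' : ∀ x : M, TangentSpace 𝓘(ℝ, E) x →ₗ[ℝ] V} (hθ' : IsConnectionForm b Z θ') {x : M}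
    (h : LinearMap.range (θ x) = LinearMap.range (θ' x)) : θ = θ' := by
  have hx : θ x = θ' x := LinearMap.ext fun v => by
    obtain ⟨w, hw⟩ : θ x v ∈ LinearMap.range (θ' x) := h ▸ ⟨v, rfl⟩
    have h1 := congrArg (fun X => Z X x) hw
    rw [hθ.apply_form hZ, hθ'.apply_form hZ] at h1
    rw [← hw, h1]
  refine funext fun y => LinearMap.ext fun v => ?_
  obtain ⟨Y, rfl⟩ := hZ.surjective y v
  obtain ⟨A, A', L, L', φ, ψ, h1, -, -, -, rfl, rfl, -, h8⟩ := exists_transport hZ x y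
  have hL := h1.eventually.self_of_nhds.2
  rw [h1.apply_eq] at hL
  have h2 := hθ.formProj_flowsAlongList hZ hL
  have h3 := hθ'.formProj_flowsAlongList hZ hL
  have h4 : formProj Z θ x = formProj Z θ' x := by rw [formProj, hx]; rfl
  rw [h4, ← h3] at h2
  have h5 := congrArg (fun A => (A * listAd b L') Y) h2
  simp only [mul_assoc, h8, mul_one] at h5
  exact h5

end ConnectionForm

/-! ### Spreading a projection over the manifold by transport. -/

section EquivariantProjections

open Set VectorField NormedSpace

variable {V : Type*} [NormedAddCommGroup V] [NormedSpace ℝ V] [FiniteDimensional ℝ V]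
  {E : Type*} [NormedAddCommGroup E] [NormedSpace ℝ E] [FiniteDimensional ℝ E]
  {M : Type*} [TopologicalSpace M] [ChartedSpace E M] [IsManifold 𝓘(ℝ, E) ∞ M]
  {b : V →L[ℝ] V →L[ℝ] V} {Z : V →ₗ[ℝ] ∀ x : M, TangentSpace 𝓘(ℝ, E) x}

lemma Transport.inv_mul {x y : M} {A A' : V →L[ℝ] V} (h : Transport b Z x y A A') : A' * A = 1 := by
  obtain ⟨-, -, -, -, -, -, -, -, -, -, h7, -⟩ := h
  exact h7

/-- The tangent map of the transporting germ sends `Z X x` to `Z (A X) y`, so the latter depends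
only on the former. With `Y = 0`, this says that `A` maps the isotropy algebra at `x` into that at
`y`. -/
lemma Transport.family_congr {x y : M} {A A' : V →L[ℝ] V} (h : Transport b Z x y A A') {X Y : V}
    (hXY : Z X x = Z Y x) : Z (A X) y = Z (A Y) y := by
  obtain ⟨L, L', φ, ψ, h1, -, -, -, rfl, -, -, -⟩ := h
  have h2 := h1.eventually.self_of_nhds.1.mfderiv_apply
  obtain rfl := h1.apply_eq
  rw [← h2, ← h2, hXY]

/-- The equivariance of a field of endomorphisms of the parameter space under all transports. -/
def IsTransportEquivariant (b : V →L[ℝ] V →L[ℝ] V)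
    (Z : V →ₗ[ℝ] ∀ x : M, TangentSpace 𝓘(ℝ, E) x) (f : M → V →L[ℝ] V) : Prop :=
  ∀ y z B B', Transport b Z y z B B' → f z * B = B * f y

variable [T2Space M]

theorem exists_isTransportEquivariant [PreconnectedSpace M] (hZ : IsTransitiveFamily b Z) {x : M}
    {P : V →L[ℝ] V} (hPZ : ∀ Y, Z (P Y) x = Z Y x) (hP0 : ∀ Y, Z Y x = 0 → P Y = 0)
    (hP : ∀ A A', Transport b Z x x A A' → P * A = A * P) :
    ∃ f : M → V →L[ℝ] V, IsTransportEquivariant b Z f ∧ f x = P ∧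
      (∀ y Y, Z (f y Y) y = Z Y y) ∧ ∀ y Y, Z Y y = 0 → f y Y = 0 := by
  -- The transports are chosen arbitrarily, with no regularity in `y`. For a transport from `y` to
  -- `z`, the chosen ones close it up to a loop at `x`, and `hP` for this loop gives equivariance.
  choose A A' hA using exists_transport hZ x
  refine ⟨fun y => A y * P * A' y, ?_, ?_, ?_, ?_⟩
  · intro y z B B' h
    have h1 := hP _ _ (((hA y).trans h).trans (hA z).symm)
    have h2 := congrArg (fun C => A z * C * A' y) h1
    simp only [mul_assoc, (hA y).symm.inv_mul, mul_one] at h2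
    rw [← mul_assoc (A z) (A' z), (hA z).symm.inv_mul, one_mul] at h2
    simpa only [mul_assoc] using h2
  · show A x * P * A' x = P
    rw [← hP _ _ (hA x), mul_assoc, (hA x).symm.inv_mul, mul_one]
  · intro y Y
    show Z (A y (P (A' y Y))) y = Z Y y
    rw [(hA y).family_congr (hPZ (A' y Y)), ← mul_apply_clm, (hA y).symm.inv_mul]
    rfl
  · intro y Y hY
    show A y (P (A' y Y)) = 0
    have h0 : Z (0 : V) y = 0 := by rw [map_zero]; rfl
    have h1 := (hA y).symm.family_congr (hY.trans h0.symm)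
    rw [map_zero, map_zero] at h1
    rw [hP0 _ h1, map_zero]

lemma IsTransportEquivariant.eq_conj {f : M → V →L[ℝ] V}
    (hf : IsTransportEquivariant b Z f) {m₀ m : M} {X : V}
    (h : Transport b Z m₀ m (exp (-b X)) (exp (b X))) :
    f m = exp (-b X) * f m₀ * exp (b X) := by
  rw [← hf _ _ _ _ h, mul_assoc, h.symm.inv_mul, mul_one]

/-- Near `m₀`, equivariance makes `f m` the conjugate of `f m₀` by `exp (b (τ m))`, where `τ` is
smooth. Regularity thus comes from equivariance alone. -/
lemma IsTransportEquivariant.contMDiff (hZ : IsTransitiveFamily b Z) {f : M → V →L[ℝ] V}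
    (hf : IsTransportEquivariant b Z f) : ContMDiff 𝓘(ℝ, E) 𝓘(ℝ, V →L[ℝ] V) ∞ f := by
  have := FiniteDimensional.complete ℝ V
  intro m₀
  obtain ⟨F, τ, hF, -, -, hτ, hτ0, hFτ⟩ := exists_transport_family hZ m₀
  have h1 : Filter.Tendsto τ (𝓝 m₀) (𝓝 0) := hτ0 ▸ hτ.continuousAt
  have h2 : ∀ᶠ m in 𝓝 m₀, f m = exp (-b (τ m)) * f m₀ * exp (b (τ m)) := by
    filter_upwards [h1.eventually hF, hFτ] with m hm hm'
    rw [hm'] at hm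
    exact hf.eq_conj hm
  have h3 : ContDiff ℝ ∞ fun X : V => exp (-b X) * f m₀ * exp (b X) :=
    ((contDiff_exp_clm.comp b.contDiff.neg).mul contDiff_const).mul
      (contDiff_exp_clm.comp b.contDiff)
  exact (h3.contMDiff.contMDiffAt.comp m₀ hτ).congr_of_eventuallyEq h2

/-- The curve `t ↦ F (t • X)` has velocity `Z X m` at `0`, and along it `f` is the conjugate of `f
m` by `exp (t b X)`; both descriptions are differentiated at `0`. -/
lemma IsTransportEquivariant.mfderiv_apply (hZ : IsTransitiveFamily b Z) {f : M → V →L[ℝ] V}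
    (hf : IsTransportEquivariant b Z f) (m : M) (X : V) :
    (mfderiv 𝓘(ℝ, E) 𝓘(ℝ, V →L[ℝ] V) f m (Z X m) : V →L[ℝ] V) = f m * b X - b X * f m := by
  have := FiniteDimensional.complete ℝ V
  obtain ⟨F, τ, hF, hF0, ⟨A, hA, hFA⟩, -, -, -⟩ := exists_transport_family hZ m
  have h1 := ((hf.contMDiff hZ).mdifferentiable (by simp) m).hasMFDerivAt
  rw [← hF0] at h1
  let D : V →L[ℝ] V →L[ℝ] V :=
    (mfderiv 𝓘(ℝ, E) 𝓘(ℝ, V →L[ℝ] V) f (F 0) : E →L[ℝ] V →L[ℝ] V).comp (A : V →L[ℝ] E)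
  have h2 : HasFDerivAt (f ∘ F) D 0 := hasMFDerivAt_iff_hasFDerivAt.1 (h1.comp (0 : V) hFA)
  have h3 : HasDerivAt (fun t : ℝ => t • X) X 0 := by
    simpa using (hasDerivAt_id (0 : ℝ)).smul_const X
  have h4 : HasDerivAt (fun t : ℝ => f (F (t • X))) (D X) 0 :=
    HasFDerivAt.comp_hasDerivAt (l := f ∘ F) (0 : ℝ) (by rwa [zero_smul]) h3
  have h5 : HasDerivAt (fun t : ℝ => exp (t • -b X) * f m * exp (t • b X))
      (f m * b X - b X * f m) 0 := by
    have h6 := ((hasDerivAt_exp_smul_const (𝕂 := ℝ) (-b X) 0).mul_const (f m)).mul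
      (hasDerivAt_exp_smul_const (𝕂 := ℝ) (b X) 0)
    refine h6.congr_deriv ?_
    simp only [zero_smul, exp_zero, one_mul, mul_one]
    rw [neg_mul, neg_add_eq_sub]
  have h6 : (fun t : ℝ => f (F (t • X))) =ᶠ[𝓝 0]
      fun t : ℝ => exp (t • -b X) * f m * exp (t • b X) := by
    have h7 : Filter.Tendsto (fun t : ℝ => t • X) (𝓝 0) (𝓝 0) := by
      simpa using h3.continuousAt.tendsto
    filter_upwards [h7.eventually hF] with t ht
    rw [hf.eq_conj ht, map_smul, smul_neg]
  have h7 := h4.unique (h5.congr_of_eventuallyEq h6)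
  rw [← h7]
  have h8 : D X = (mfderiv 𝓘(ℝ, E) 𝓘(ℝ, V →L[ℝ] V) f (F 0) : E →L[ℝ] V →L[ℝ] V) (Z X m : E) :=
    congrArg (mfderiv 𝓘(ℝ, E) 𝓘(ℝ, V →L[ℝ] V) f (F 0) : E →L[ℝ] V →L[ℝ] V) (hA X)
  rw [h8, hF0]

end EquivariantProjections

/-! ### Arbitrary vector fields as combinations of fundamental fields. -/

section LocalCoordinates

open Set VectorField NormedSpace

variable {V : Type*} [NormedAddCommGroup V] [NormedSpace ℝ V] [FiniteDimensional ℝ V]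
  {E : Type*} [NormedAddCommGroup E] [NormedSpace ℝ E] [FiniteDimensional ℝ E]
  {M : Type*} [TopologicalSpace M] [ChartedSpace E M] [IsManifold 𝓘(ℝ, E) ∞ M]
  {b : V →L[ℝ] V →L[ℝ] V} {Z : V →ₗ[ℝ] ∀ x : M, TangentSpace 𝓘(ℝ, E) x}

/-- Near `m₀`, tangent vectors are values of fields of the family which depend smoothly on the
tangent vector. -/
theorem exists_smooth_lift (hZ : IsTransitiveFamily b Z) (m₀ : M) :
    ∃ S : TangentBundle 𝓘(ℝ, E) M → V,
      (∀ v, v.proj = m₀ → ContMDiffAt 𝓘(ℝ, E).tangent 𝓘(ℝ, V) ∞ S v) ∧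
      ∀ᶠ m in 𝓝 m₀, ∀ v : TangentSpace 𝓘(ℝ, E) m, Z (S ⟨m, v⟩) m = v := by
  have hm₀ := mem_chart_source E m₀
  obtain ⟨U, σ, hUo, hqU, hUΩ, hσ, hσz⟩ := exists_smooth_rightInverse
    (chartAt E m₀).open_target (contDiffOn_chartFamily hZ m₀)
    ((chartAt E m₀).map_source hm₀)
    (chartFamily_surjective hZ ((chartAt E m₀).map_source hm₀))
  refine ⟨fun v => σ (chartAt E m₀ v.proj)
    (mfderiv 𝓘(ℝ, E) 𝓘(ℝ, E) (chartAt E m₀) v.proj v.2), ?_, ?_⟩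
  · rintro v rfl
    have h0 : IsManifold 𝓘(ℝ, E) 1 M := IsManifold.of_le (n := ∞) (by simp)
    have h1 : ContMDiffOn 𝓘(ℝ, E).tangent 𝓘(ℝ, E).tangent ∞
        (tangentMapWithin 𝓘(ℝ, E) 𝓘(ℝ, E) (chartAt E v.proj) (chartAt E v.proj).source)
        (Bundle.TotalSpace.proj ⁻¹' (chartAt E v.proj).source) :=
      (contMDiffOn_chart (I := 𝓘(ℝ, E)) (n := ∞)).contMDiffOn_tangentMapWithin (by simp)
        (chartAt E v.proj).open_source.uniqueMDiffOn
    have hnhds : (Bundle.TotalSpace.proj ⁻¹' (chartAt E v.proj).source :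
        Set (TangentBundle 𝓘(ℝ, E) M)) ∈ 𝓝 v :=
      ((chartAt E v.proj).open_source.preimage
        (FiberBundle.continuous_proj E (TangentSpace 𝓘(ℝ, E)))).mem_nhds hm₀
    have h2 := (contMDiff_snd_tangentBundle_modelSpace E 𝓘(ℝ, E)
      (n := ∞)).contMDiffAt.comp v (h1.contMDiffAt hnhds)
    have h3 : ContMDiffAt 𝓘(ℝ, E).tangent 𝓘(ℝ, E) ∞ (fun w : TangentBundle 𝓘(ℝ, E) M =>
        (mfderiv 𝓘(ℝ, E) 𝓘(ℝ, E) (chartAt E v.proj) w.proj w.2 : E)) v := by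
      refine h2.congr_of_eventuallyEq (Filter.mem_of_superset hnhds fun w hw => ?_)
      show mfderiv 𝓘(ℝ, E) 𝓘(ℝ, E) (chartAt E v.proj) w.proj w.2 =
        mfderivWithin 𝓘(ℝ, E) 𝓘(ℝ, E) (chartAt E v.proj) (chartAt E v.proj).source w.proj w.2
      rw [mfderivWithin_of_isOpen (chartAt E v.proj).open_source hw]
    have h4 : ContMDiffAt 𝓘(ℝ, E).tangent 𝓘(ℝ, E →L[ℝ] V) ∞
        (fun w : TangentBundle 𝓘(ℝ, E) M => σ (chartAt E v.proj w.proj)) v :=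
      (hσ.contDiffAt (hUo.mem_nhds hqU)).contMDiffAt.comp v
        ((contMDiffAt_chartAt hm₀).comp v
          (Bundle.contMDiff_proj (TangentSpace 𝓘(ℝ, E))).contMDiffAt)
    exact h4.clm_apply h3
  · have h1 := (contMDiffAt_chartAt hm₀).continuousAt.eventually (hUo.mem_nhds hqU)
    filter_upwards [h1, (chartAt E m₀).open_source.mem_nhds hm₀] with m hm hms v
    have h2 := hσz _ hm (mfderiv 𝓘(ℝ, E) 𝓘(ℝ, E) (chartAt E m₀) m v)
    rw [← mfderiv_chartAt_family hms] at h2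
    have h3 := (mdifferentiable_chartAt m₀).symm_comp_deriv hms
    have h4 := fun w : TangentSpace 𝓘(ℝ, E) m => congrArg (fun A => A w) h3
    have h5 := congrArg (mfderiv 𝓘(ℝ, E) 𝓘(ℝ, E) (chartAt E m₀).symm (chartAt E m₀ m)) h2
    exact (h4 _).symm.trans (h5.trans (h4 v))

lemma mlieBracket_sum_smul (hZ : IsTransitiveFamily b Z) {ι : Type*} (s : Finset ι) (g : ι → M → ℝ)
    (Y : ι → V) (X : V) {x : M} (hg : ∀ i, MDifferentiableAt 𝓘(ℝ, E) 𝓘(ℝ, ℝ) (g i) x) :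
    mlieBracket 𝓘(ℝ, E) (Z X) (∑ i ∈ s, g i • Z (Y i)) x =
      Z (∑ i ∈ s, ((mvfderiv 𝓘(ℝ, E) (g i) x (Z X x)) • Y i + g i x • b X (Y i))) x := by
  classical
  have h0 : IsManifold 𝓘(ℝ, E) 1 M := IsManifold.of_le (n := ∞) (by simp)
  have hY : ∀ i, MDifferentiableAt 𝓘(ℝ, E) 𝓘(ℝ, E).tangent
      (fun y => (⟨y, Z (Y i) y⟩ : TangentBundle 𝓘(ℝ, E) M)) x := fun i =>
    (hZ.smooth (Y i)).mdifferentiable (by simp) x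
  induction s using Finset.induction_on with
  | empty =>
    simp only [Finset.sum_empty, map_zero]
    rw [mlieBracket_zero_right]
  | insert i s his ih =>
    have h1 : MDifferentiableAt 𝓘(ℝ, E) 𝓘(ℝ, E).tangent
        (fun y => (⟨y, (g i • Z (Y i)) y⟩ : TangentBundle 𝓘(ℝ, E) M)) x :=
      (hg i).smul_section (hY i)
    have h2 : MDifferentiableAt 𝓘(ℝ, E) 𝓘(ℝ, E).tangent
        (fun y => (⟨y, (∑ i ∈ s, g i • Z (Y i)) y⟩ : TangentBundle 𝓘(ℝ, E) M)) x := by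
      have := MDifferentiableAt.sum_section (s := s) (x₀ := x) (t := fun i => g i • Z (Y i))
        fun i _ => (hg i).smul_section (hY i)
      simpa only [Finset.sum_apply] using this
    rw [Finset.sum_insert his, Finset.sum_insert his, mlieBracket_add_right h1 h2, ih,
      mlieBracket_smul_right (hg i) (hY i), ← hZ.bracket, map_add Z (_ + _), map_add Z (_ • _),
      map_smul, map_smul]
    rfl

/-- Leibniz rule for the bracket, after expanding `h` in a basis of `V`. -/
theorem mlieBracket_family_combination (hZ : IsTransitiveFamily b Z) {h : M → V} {x : M}
    (hh : MDifferentiableAt 𝓘(ℝ, E) 𝓘(ℝ, V) h x) (X : V) :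
    mlieBracket 𝓘(ℝ, E) (Z X) (fun y => Z (h y) y) x =
      Z ((show V from mfderiv 𝓘(ℝ, E) 𝓘(ℝ, V) h x (Z X x)) + b X (h x)) x := by
  let B := Module.finBasis ℝ V
  let co : ∀ i, V →L[ℝ] ℝ := fun i => LinearMap.toContinuousLinearMap (B.coord i)
  have hsum : ∀ v : V, v = ∑ i, co i v • B i := fun v => (B.sum_repr v).symm
  have h1 : (fun y => Z (h y) y) = ∑ i, (fun y => co i (h y)) • Z (B i) := by
    funext y
    conv_lhs => rw [hsum (h y)]
    rw [map_sum, Finset.sum_apply, Finset.sum_apply]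
    refine Finset.sum_congr rfl fun i _ => ?_
    rw [map_smul]
    rfl
  have hd : ∀ i, HasMFDerivAt 𝓘(ℝ, E) 𝓘(ℝ, ℝ) (fun y => co i (h y)) x
      ((co i).comp (mfderiv 𝓘(ℝ, E) 𝓘(ℝ, V) h x : E →L[ℝ] V)) := fun i =>
    (co i).hasFDerivAt.hasMFDerivAt.comp x hh.hasMFDerivAt
  rw [h1, mlieBracket_sum_smul hZ _ _ _ _ fun i => (hd i).mdifferentiableAt]
  refine congrArg (fun v => Z v x) ?_
  rw [Finset.sum_add_distrib]
  conv_rhs => rw [hsum (show V from mfderiv 𝓘(ℝ, E) 𝓘(ℝ, V) h x (Z X x)), hsum (h x), map_sum]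
  congr 1
  · refine Finset.sum_congr rfl fun i _ => ?_
    congr 1
    exact congrArg (fun A : E →L[ℝ] ℝ => A (Z X x)) (hd i).mfderiv
  · exact Finset.sum_congr rfl fun i _ => (map_smul _ _ _).symm

end LocalCoordinates

/-! ### The connection form defined by an equivariant projection. -/

section FormOfProjection

open Set VectorField NormedSpace

variable {V : Type*} [NormedAddCommGroup V] [NormedSpace ℝ V] [FiniteDimensional ℝ V]
  {E : Type*} [NormedAddCommGroup E] [NormedSpace ℝ E] [FiniteDimensional ℝ E]
  {M : Type*} [TopologicalSpace M] [ChartedSpace E M] [IsManifold 𝓘(ℝ, E) ∞ M]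
  {b : V →L[ℝ] V →L[ℝ] V} {Z : V →ₗ[ℝ] ∀ x : M, TangentSpace 𝓘(ℝ, E) x}

lemma exists_form_of_forall_ker_le (hZ : IsTransitiveFamily b Z) {f : M → V →L[ℝ] V}
    (hf : ∀ y Y, Z Y y = 0 → f y Y = 0) :
    ∃ θ : ∀ x : M, TangentSpace 𝓘(ℝ, E) x →ₗ[ℝ] V, ∀ x Y, θ x (Z Y x) = f x Y := by
  have h : ∀ x : M, ∃ θ : TangentSpace 𝓘(ℝ, E) x →ₗ[ℝ] V, ∀ Y, θ (Z Y x) = f x Y := fun x => by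
    let ev : V →ₗ[ℝ] TangentSpace 𝓘(ℝ, E) x := (LinearMap.proj x).comp Z
    obtain ⟨s, hs⟩ := ev.exists_rightInverse_of_surjective
      (LinearMap.range_eq_top.2 (hZ.surjective x))
    refine ⟨(f x : V →ₗ[ℝ] V) ∘ₗ s, fun Y => ?_⟩
    have h1 : ev (s (ev Y) - Y) = 0 := by
      rw [map_sub]
      exact sub_eq_zero.2 (LinearMap.congr_fun hs (ev Y))
    have h2 := hf x _ h1
    rw [map_sub] at h2
    exact sub_eq_zero.1 h2
  choose θ hθ using h
  exact ⟨θ, hθ⟩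

lemma hasMFDerivAt_clm_apply {f : M → V →L[ℝ] V} {h : M → V} {m : M} {f' : E →L[ℝ] V →L[ℝ] V}
    {h' : E →L[ℝ] V} (hf : HasMFDerivAt 𝓘(ℝ, E) 𝓘(ℝ, V →L[ℝ] V) f m f')
    (hh : HasMFDerivAt 𝓘(ℝ, E) 𝓘(ℝ, V) h m h') :
    HasMFDerivAt 𝓘(ℝ, E) 𝓘(ℝ, V) (fun y => f y (h y)) m ((f m).comp h' + f'.flip (h m)) := by
  refine ⟨hf.1.clm_apply hh.1, ?_⟩
  have h1 : HasFDerivWithinAt (f ∘ (extChartAt 𝓘(ℝ, E) m).symm) f' _ _ := hf.2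
  have h2 : HasFDerivWithinAt (h ∘ (extChartAt 𝓘(ℝ, E) m).symm) h' _ _ := hh.2
  have h3 := h1.clm_apply h2
  rw [Function.comp_apply, Function.comp_apply, extChartAt_to_inv] at h3
  exact h3

variable [T2Space M]

/-- The equivariant field `f` kills the isotropy algebras, so it factors through evaluation and
gives `θ`. Locally a vector field is `Z h` with a smooth `V`-valued `h`, and then `θ(η) = f h`. The
terms with the derivative of `h` cancel in the Lie derivative, and the derivative `f (b X) - (b X)
f` of `f` leaves `-b X (f h)`. -/
theorem exists_connectionForm [PreconnectedSpace M] (hZ : IsTransitiveFamily b Z) {x : M}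
    {P : V →L[ℝ] V} (hPZ : ∀ Y, Z (P Y) x = Z Y x) (hP0 : ∀ Y, Z Y x = 0 → P Y = 0)
    (hP : ∀ A A', Transport b Z x x A A' → P * A = A * P) :
    ∃ θ : ∀ x : M, TangentSpace 𝓘(ℝ, E) x →ₗ[ℝ] V, IsConnectionForm b Z θ ∧
      ∀ Y, θ x (Z Y x) = P Y := by
  obtain ⟨f, hf, rfl, hfZ, hf0⟩ := exists_isTransportEquivariant hZ hPZ hP0 hP
  obtain ⟨θ, hθ⟩ := exists_form_of_forall_ker_le hZ hf0
  have hfs := hf.contMDiff hZ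
  refine ⟨θ, ⟨fun v => ?_, fun X η hη m => ?_, fun m X => ?_⟩, hθ x⟩
  · obtain ⟨S, hS, hSZ⟩ := exists_smooth_lift hZ v.proj
    have h1 := ((hfs.comp (Bundle.contMDiff_proj (TangentSpace 𝓘(ℝ, E)))).contMDiffAt
      (x := v)).clm_apply (hS v rfl)
    refine h1.congr_of_eventuallyEq ?_
    filter_upwards [(FiberBundle.continuous_proj E (TangentSpace 𝓘(ℝ, E))).continuousAt.eventually
      hSZ] with w hw
    have h2 := hθ w.proj (S w)
    rw [show Z (S w) w.proj = w.2 from hw w.2] at h2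
    exact h2
  · obtain ⟨S, hS, hSZ⟩ := exists_smooth_lift hZ m
    have hh : MDifferentiableAt 𝓘(ℝ, E) 𝓘(ℝ, V) (fun y => S ⟨y, η y⟩) m :=
      ((hS ⟨m, η m⟩ rfl).comp m (hη m)).mdifferentiableAt (by simp)
    set h : M → V := fun y => S ⟨y, η y⟩
    have hη' : η =ᶠ[𝓝 m] fun y => Z (h y) y := hSZ.mono fun y hy => (hy (η y)).symm
    have hθη : (fun y => θ y (η y)) =ᶠ[𝓝 m] fun y => f y (h y) := hη'.mono fun y hy => by
      dsimp only at hy ⊢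
      rw [hy, hθ]
    have h1 := (Filter.EventuallyEq.refl (𝓝 m) (Z X)).mlieBracket_vectorField_eq
      (I := 𝓘(ℝ, E)) hη'
    rw [h1, mlieBracket_family_combination hZ hh X, hθ,
      show θ m (η m) = f m (h m) from hθη.self_of_nhds]
    have hfd := (hfs.mdifferentiable (by simp) m).hasMFDerivAt
    have h2 := hasMFDerivAt_clm_apply hfd hh.hasMFDerivAt
    let df : E →L[ℝ] V →L[ℝ] V := mfderiv 𝓘(ℝ, E) 𝓘(ℝ, V →L[ℝ] V) f m
    let dh : E →L[ℝ] V := mfderiv 𝓘(ℝ, E) 𝓘(ℝ, V) h m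
    let dθ : E →L[ℝ] V := mfderiv 𝓘(ℝ, E) 𝓘(ℝ, V) (fun y => θ y (η y)) m
    let u : E := Z X m
    have h3 : dθ u = f m (dh u) + df u (h m) :=
      congrArg (fun A : E →L[ℝ] V => A u) (hθη.mfderiv_eq.trans h2.mfderiv)
    have h4 : df u (h m) = f m (b X (h m)) - b X (f m (h m)) :=
      congrArg (fun A : V →L[ℝ] V => A (h m)) (hf.mfderiv_apply hZ m X)
    show dθ u - f m (dh u + b X (h m)) = -b X (f m (h m))
    rw [h3, h4, map_add]
    abel
  · rw [hθ, hfZ]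

end FormOfProjection

/-! ### From invertible germs to local diffeomorphisms. -/

section LocalDiffeomorphisms

open Set

variable {E : Type*} [NormedAddCommGroup E] [NormedSpace ℝ E] [FiniteDimensional ℝ E]
  {M : Type*} [TopologicalSpace M] [ChartedSpace E M] [IsManifold 𝓘(ℝ, E) ∞ M]

/-- Mutually inverse germs of smooth maps are represented by a diffeomorphism between connected
open sets. -/
lemma exists_openPartialHomeomorph_of_germs {φ ψ : M → M} {x : M} {p : M → Prop} (hφx : φ x = x)
    (hφ : ∀ᶠ q in 𝓝 x, ContMDiffAt 𝓘(ℝ, E) 𝓘(ℝ, E) ∞ φ q)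
    (hψ : ∀ᶠ q in 𝓝 x, ContMDiffAt 𝓘(ℝ, E) 𝓘(ℝ, E) ∞ ψ q) (hψφ : ∀ᶠ q in 𝓝 x, ψ (φ q) = q)
    (hφψ : ∀ᶠ q in 𝓝 x, φ (ψ q) = q) (hp : ∀ᶠ q in 𝓝 x, p q) :
    ∃ Φ : OpenPartialHomeomorph M M, (Φ : M → M) = φ ∧ x ∈ Φ.source ∧ IsConnected Φ.source ∧
      ContMDiffOn 𝓘(ℝ, E) 𝓘(ℝ, E) ∞ Φ Φ.source ∧ ContMDiffOn 𝓘(ℝ, E) 𝓘(ℝ, E) ∞ Φ.symm Φ.target ∧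
      ∀ q ∈ Φ.source, p q := by
  obtain ⟨U, hU, hUo, hxU⟩ := eventually_nhds_iff.1 (hφ.and (hψφ.and hp))
  obtain ⟨W, hW, hWo, hxW⟩ := eventually_nhds_iff.1 (hψ.and hφψ)
  have hφc : ContinuousOn φ U := fun q hq => (hU q hq).1.continuousAt.continuousWithinAt
  have hψc : ContinuousOn ψ W := fun q hq => (hW q hq).1.continuousAt.continuousWithinAt
  let Φ : OpenPartialHomeomorph M M :=
    { toFun := φ
      invFun := ψ
      source := U ∩ φ ⁻¹' W
      target := W ∩ ψ ⁻¹' U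
      map_source' := fun q hq => ⟨hq.2, by
        show ψ (φ q) ∈ U
        rw [(hU q hq.1).2.1]; exact hq.1⟩
      map_target' := fun q hq => ⟨hq.2, by
        show φ (ψ q) ∈ W
        rw [(hW q hq.1).2]; exact hq.1⟩
      left_inv' := fun q hq => (hU q hq.1).2.1
      right_inv' := fun q hq => (hW q hq.1).2
      continuousOn_toFun := hφc.mono inter_subset_left
      continuousOn_invFun := hψc.mono inter_subset_left
      open_source := hφc.isOpen_inter_preimage hUo hWo
      open_target := hψc.isOpen_inter_preimage hWo hUo }
  have hxΦ : x ∈ Φ.source := ⟨hxU, by show φ x ∈ W; rwa [hφx]⟩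
  have : LocallyConnectedSpace M := ChartedSpace.locallyConnectedSpace E M
  -- The pseudogroup asks for a connected source; since `M` is locally connected, the component of
  -- `x` is open and serves as one.
  have hC : IsOpen (connectedComponentIn Φ.source x) := Φ.open_source.connectedComponentIn
  have hCΦ : connectedComponentIn Φ.source x ⊆ Φ.source := connectedComponentIn_subset _ _
  have hs : (Φ.restrOpen _ hC).source = connectedComponentIn Φ.source x :=
    inter_eq_right.2 hCΦ
  have ht : (Φ.restrOpen _ hC).target ⊆ Φ.target := inter_subset_left
  refine ⟨Φ.restrOpen _ hC, rfl, ?_, ?_, ?_, ?_, ?_⟩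
  · rw [hs]
    exact mem_connectedComponentIn hxΦ
  · rw [hs]
    exact isConnected_connectedComponentIn_iff.2 hxΦ
  · rw [hs]
    exact fun q hq => (hU q (hCΦ hq).1).1.contMDiffWithinAt
  · exact fun q hq => (hW q (ht hq).1).1.contMDiffWithinAt
  · rw [hs]
    exact fun q hq => (hU q (hCΦ hq).1).2.2

end LocalDiffeomorphisms

/-! ### From Lie algebra actions to normed families; the representation `Ad`. -/

section Parametrization

open Set VectorField NormedSpace

variable {𝔤 : Type*} [LieRing 𝔤] [LieAlgebra ℝ 𝔤]
  {V : Type*} [NormedAddCommGroup V] [NormedSpace ℝ V] [FiniteDimensional ℝ V]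
  {E : Type*} [NormedAddCommGroup E] [NormedSpace ℝ E] [FiniteDimensional ℝ E]
  {M : Type*} [TopologicalSpace M] [ChartedSpace E M] [IsManifold 𝓘(ℝ, E) ∞ M]

/-- The Lie bracket of `𝔤` transported to a normed space. -/
def transportedBracket (e : 𝔤 ≃ₗ[ℝ] V) : V →L[ℝ] V →L[ℝ] V :=
  LinearMap.toContinuousLinearMap
    ((LinearMap.toContinuousLinearMap : (V →ₗ[ℝ] V) ≃ₗ[ℝ] (V →L[ℝ] V)).toLinearMap ∘ₗ
      e.conj.toLinearMap ∘ₗ (LieAlgebra.ad ℝ 𝔤 : 𝔤 →ₗ[ℝ] Module.End ℝ 𝔤) ∘ₗ e.symm.toLinearMap)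

lemma transportedBracket_apply (e : 𝔤 ≃ₗ[ℝ] V) (X Y : V) :
    transportedBracket e X Y = e ⁅e.symm X, e.symm Y⁆ := rfl

lemma transportedBracket_jacobi (e : 𝔤 ≃ₗ[ℝ] V) (X Y W : V) :
    transportedBracket e X (transportedBracket e Y W) =
      transportedBracket e (transportedBracket e X Y) W +
        transportedBracket e Y (transportedBracket e X W) := by
  simp only [transportedBracket_apply, LinearEquiv.symm_apply_apply, ← map_add]
  rw [leibniz_lie]

namespace LieAlgAction

variable (ζ : LieAlgAction 𝔤 E M) (e : 𝔤 ≃ₗ[ℝ] V)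

/-- The fundamental fields, parametrized by a normed space. -/
def family : V →ₗ[ℝ] ∀ x : M, TangentSpace 𝓘(ℝ, E) x := ζ.field ∘ₗ e.symm.toLinearMap

lemma family_apply (X : 𝔤) : ζ.family e (e X) = ζ.field X :=
  congrArg ζ.field (e.symm_apply_apply X)

variable {ζ}

lemma IsTransitive.isTransitiveFamily (hζ : ζ.IsTransitive) :
    IsTransitiveFamily (transportedBracket e) (ζ.family e) where
  smooth Y := ζ.smooth (e.symm Y)
  bracket X Y := by
    rw [transportedBracket_apply, family_apply, ζ.map_lie]
    rfl
  surjective x v := by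
    obtain ⟨X, rfl⟩ := hζ x v
    exact ⟨e X, congrFun (ζ.family_apply e X) x⟩

lemma FlowsToList.flowsAlongList {L : List (𝔤 × ℝ)} {y z : M} (h : ζ.FlowsToList L y z) :
    FlowsAlongList (ζ.family e) (L.map fun p => (e p.1, p.2)) y z := by
  induction L generalizing y with
  | nil => exact h
  | cons p L ih =>
    obtain ⟨w, h1, h2⟩ := h
    exact ⟨w, (by rw [family_apply]; exact h1), ih h2⟩

lemma flowsToList_of_flowsAlongList {L : List (V × ℝ)} {y z : M}
    (h : FlowsAlongList (ζ.family e) L y z) :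
    ζ.FlowsToList (L.map fun p => (e.symm p.1, p.2)) y z := by
  induction L generalizing y with
  | nil => exact h
  | cons p L ih =>
    obtain ⟨w, h1, h2⟩ := h
    exact ⟨w, h1, ih h2⟩

variable (ζ) in
/-- The adjoint action of a composition of flows is a Lie algebra automorphism. -/
lemma exists_lieEquiv (L : List (V × ℝ)) :
    ∃ A : 𝔤 ≃ₗ⁅ℝ⁆ 𝔤, ∀ X, e (A X) = listAd (transportedBracket e) L (e X) := by
  have := FiniteDimensional.complete ℝ V
  let f : 𝔤 →ₗ⁅ℝ⁆ 𝔤 :=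
    { toLinearMap := e.symm.toLinearMap ∘ₗ
        (listAd (transportedBracket e) L : V →ₗ[ℝ] V) ∘ₗ e.toLinearMap
      map_lie' := fun {X Y} => by
        have h := listAd_bracket (transportedBracket_jacobi e) L (e X) (e Y)
        rw [transportedBracket_apply, transportedBracket_apply, e.symm_apply_apply,
          e.symm_apply_apply] at h
        show e.symm (listAd (transportedBracket e) L (e ⁅X, Y⁆)) = _
        rw [h, e.symm_apply_apply]
        rfl }
  have hf : Function.Bijective f :=
    e.symm.bijective.comp ((listAd_bijective (transportedBracket e) L).comp e.bijective)
  exact ⟨LieEquiv.ofBijective f hf, fun X => e.apply_symm_apply _⟩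

lemma isAdjoint_of_intertwinesAt (hζ : ζ.IsTransitive) {B : V →L[ℝ] V} {A : 𝔤 ≃ₗ⁅ℝ⁆ 𝔤}
    (hA : ∀ X, e (A X) = B (e X)) {φ : M → M} {x : M}
    (hφ : ∀ᶠ q in 𝓝 x, IntertwinesAt (ζ.family e) B φ q) :
    ζ.IsAdjoint x (φ : (𝓝 x).Germ M) A := by
  refine ⟨φ, rfl, fun X => hφ.mono fun q hq => ?_⟩
  have hB : Function.Surjective B := fun v =>
    ⟨e (A.symm (e.symm v)), by rw [← hA, A.apply_symm_apply, e.apply_symm_apply]⟩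
  have h := mpullback_eq_of_intertwinesAt (hζ.isTransitiveFamily e) hB hq (e (A.symm X))
  rwa [← hA, A.apply_symm_apply, family_apply, family_apply] at h

variable [T2Space M] [PreconnectedSpace M]

/-- Both automorphisms describe the pullback by the same germ, so `ζ` takes the same germ at `x` on
`A.symm X` and `B.symm X`; effectiveness makes these equal. -/
lemma IsAdjoint.unique (e : 𝔤 ≃ₗ[ℝ] V) (hζ : ζ.IsTransitive) (heff : ζ.IsEffective) {x : M} {γ : (𝓝 x).Germ M}
    {A B : 𝔤 ≃ₗ⁅ℝ⁆ 𝔤} (hA : ζ.IsAdjoint x γ A) (hB : ζ.IsAdjoint x γ B) : A = B := by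
  obtain ⟨φ, rfl, hφ⟩ := hA
  obtain ⟨ψ, hφψ, hψ⟩ := hB
  have hinj : Function.Injective (ζ.family e) := heff.comp e.symm.injective
  have h : ∀ X, A.symm X = B.symm X := fun X => e.injective <|
    eq_of_eventually_family_eq (hζ.isTransitiveFamily e) hinj (x := x) <| by
      filter_upwards [hφ X, hψ X, mpullback_eventuallyEq (Filter.Germ.coe_eq.1 hφψ) (ζ.field X)]
        with y h1 h2 h3
      rw [family_apply, family_apply, ← h1, ← h2, h3]
  ext X
  rw [← B.apply_symm_apply (A X), ← h, A.symm_apply_apply]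

/-- The adjoint action of an element of the isotropy group. -/
lemma exists_isAdjoint (hζ : ζ.IsTransitive) {x : M} {γ : (𝓝 x).Germ M}
    (hγ : γ ∈ ζ.isotropyGroup x) : ∃ (A : 𝔤 ≃ₗ⁅ℝ⁆ 𝔤) (L : List (V × ℝ)), ζ.IsAdjoint x γ A ∧
      (∀ X, e (A X) = listAd (transportedBracket e) L (e X)) ∧
      FlowsAlongList (ζ.family e) L x x := by
  obtain ⟨Φ, ⟨-, -, -, L, hL⟩, hx, hΦx, rfl⟩ := hγ
  have hflow := fun y hy => (hL y hy).flowsAlongList e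
  have hLx := hflow x hx
  obtain ⟨φ, -, hφ⟩ := hLx.exists_intertwining (hζ.isTransitiveFamily e)
  obtain ⟨A, hA⟩ := exists_lieEquiv e (L.map fun p => (e p.1, p.2))
  rw [hΦx] at hLx
  refine ⟨A, _, ?_, hA, hLx⟩
  -- Uniqueness of flows identifies the given diffeomorphism with the intertwining map of its list.
  have h : (Φ : M → M) =ᶠ[𝓝 x] φ := by
    filter_upwards [hφ, Φ.open_source.mem_nhds hx] with q hq hqs
    exact hq.2 _ (hflow q hqs)
  rw [Filter.Germ.coe_eq.2 h]
  exact isAdjoint_of_intertwinesAt e hζ hA (hφ.mono fun q hq => hq.1)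

/-- Transports from `x` to itself come from the isotropy group. -/
lemma exists_isAdjoint_of_transport (hζ : ζ.IsTransitive) {x : M} {B B' : V →L[ℝ] V}
    (h : Transport (transportedBracket e) (ζ.family e) x x B B') :
    ∃ γ ∈ ζ.isotropyGroup x, ∃ A : 𝔤 ≃ₗ⁅ℝ⁆ 𝔤, ζ.IsAdjoint x γ A ∧ ∀ X, e (A X) = B (e X) := by
  obtain ⟨L, L', φ, ψ, h1, h2, h3, h4, rfl, -, -, -⟩ := h
  obtain ⟨Φ, hΦ, hx, hconn, hs, ht, hp⟩ := exists_openPartialHomeomorph_of_germs h1.apply_eq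
    (h1.eventually.mono fun q hq => hq.1.smooth)
    (h2.eventually.mono fun q hq => hq.1.smooth) h3 h4 (h1.eventually.mono fun q hq => hq.2)
  obtain ⟨A, hA⟩ := exists_lieEquiv e L
  refine ⟨(φ : (𝓝 x).Germ M), ⟨Φ, ⟨hconn, hs, ht, _, fun q hq =>
    flowsToList_of_flowsAlongList e (hΦ ▸ hp q hq)⟩, hx, hΦ ▸ h1.apply_eq, by rw [hΦ]⟩, A, ?_, hA⟩
  exact isAdjoint_of_intertwinesAt e hζ hA (h1.eventually.mono fun q hq => hq.1)

end LieAlgAction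

end Parametrization

/-! ### Principal connection forms and invariant complements. -/

section PrincipalConnectionForms

open Set VectorField NormedSpace

variable {𝔤 : Type*} [LieRing 𝔤] [LieAlgebra ℝ 𝔤] {n : ℕ}
  {E : Type*} [NormedAddCommGroup E] [NormedSpace ℝ E] [FiniteDimensional ℝ E]
  {M : Type*} [TopologicalSpace M] [ChartedSpace E M] [IsManifold 𝓘(ℝ, E) ∞ M]

lemma mfderiv_clm_comp_apply {V : Type*} [NormedAddCommGroup V] [NormedSpace ℝ V] {g : M → V}
    {x : M} (hg : MDifferentiableAt 𝓘(ℝ, E) 𝓘(ℝ, V) g x) (F : V →L[ℝ] ℝ)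
    (v : TangentSpace 𝓘(ℝ, E) x) :
    (show ℝ from mfderiv 𝓘(ℝ, E) 𝓘(ℝ, ℝ) (fun y => F (g y)) x v) =
      F (show V from mfderiv 𝓘(ℝ, E) 𝓘(ℝ, V) g x v) :=
  congrArg (fun A : E →L[ℝ] ℝ => A v) (F.hasFDerivAt.hasMFDerivAt.comp x hg.hasMFDerivAt).mfderiv

namespace LieAlgAction

variable {ζ : LieAlgAction 𝔤 E M} {θ : ∀ x : M, TangentSpace 𝓘(ℝ, E) x →ₗ[ℝ] 𝔤}

/-- With values in `Fin n → ℝ`, smoothness and equivariance can be checked on coordinates, which are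
linear functionals on `𝔤`. -/
lemma IsPrincipalConnectionForm.isConnectionForm (e : 𝔤 ≃ₗ[ℝ] (Fin n → ℝ))
    (hθ : ζ.IsPrincipalConnectionForm θ) :
    IsConnectionForm (transportedBracket e) (ζ.family e) fun x => e.toLinearMap ∘ₗ θ x := by
  have hs : ContMDiff 𝓘(ℝ, E).tangent 𝓘(ℝ, Fin n → ℝ) ∞
      (fun v : TangentBundle 𝓘(ℝ, E) M => e (θ v.proj v.2)) :=
    contMDiff_pi_space.2 fun i => hθ.smooth (LinearMap.proj i ∘ₗ e.toLinearMap)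
  refine ⟨hs, fun X η hη x => ?_, fun x X => ?_⟩
  · funext i
    have h1 := hθ.equivariant (e.symm X) (LinearMap.proj i ∘ₗ e.toLinearMap) η hη x
    have h2 := mfderiv_clm_comp_apply (((hs.comp hη).mdifferentiable (by simp)) x)
      (ContinuousLinearMap.proj (R := ℝ) (φ := fun _ : Fin n => ℝ) i) (ζ.field (e.symm X) x)
    refine (congrArg (· - _) h2.symm).trans (h1.trans ?_)
    show e (-⁅e.symm X, θ x (η x)⁆) i = -(e ⁅e.symm X, e.symm (e (θ x (η x)))⁆) i
    rw [map_neg, e.symm_apply_apply]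
    rfl
  · show ζ.field (e.symm (e (θ x (ζ.field (e.symm X) x)))) x = ζ.field (e.symm X) x
    rw [e.symm_apply_apply]
    exact LinearMap.congr_fun (hθ.reproduces x) (e.symm X)

lemma isPrincipalConnectionForm_of_isConnectionForm (e : 𝔤 ≃ₗ[ℝ] (Fin n → ℝ))
    (hθ : IsConnectionForm (transportedBracket e) (ζ.family e) fun x => e.toLinearMap ∘ₗ θ x) :
    ζ.IsPrincipalConnectionForm θ := by
  have hf : ∀ (f : Module.Dual ℝ 𝔤) (Y : 𝔤),
      LinearMap.toContinuousLinearMap (f ∘ₗ e.symm.toLinearMap) (e Y) = f Y := fun f Y =>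
    congrArg f (e.symm_apply_apply Y)
  refine ⟨fun f => ?_, fun X f η hη x => ?_, fun x => LinearMap.ext fun X => ?_⟩
  · have h1 := (LinearMap.toContinuousLinearMap (f ∘ₗ e.symm.toLinearMap)).contMDiff.comp hθ.smooth
    exact h1.congr fun v => (hf f _).symm
  · have h1 := hθ.equivariant (e X) η hη x
    have h2 := mfderiv_clm_comp_apply (((hθ.smooth.comp hη).mdifferentiable (by simp)) x)
      (LinearMap.toContinuousLinearMap (f ∘ₗ e.symm.toLinearMap)) (ζ.family e (e X) x)
    have h3 := congrArg (LinearMap.toContinuousLinearMap (f ∘ₗ e.symm.toLinearMap)) h1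
    rw [map_sub, family_apply] at h3
    rw [family_apply] at h2
    have h4 : (fun y => LinearMap.toContinuousLinearMap (f ∘ₗ e.symm.toLinearMap)
        (e (θ y (η y)))) = fun y => f (θ y (η y)) := funext fun y => hf f _
    have h5 : (show ℝ from mfderiv 𝓘(ℝ, E) 𝓘(ℝ, ℝ) (fun y => f (θ y (η y))) x (ζ.field X x)) = _ :=
      h4 ▸ h2
    refine (congrArg₂ (· - ·) h5 (hf f _).symm).trans (h3.trans ?_)
    show LinearMap.toContinuousLinearMap (f ∘ₗ e.symm.toLinearMap)
      (-e ⁅e.symm (e X), e.symm (e (θ x (η x)))⁆) = _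
    rw [← map_neg e, hf, e.symm_apply_apply, e.symm_apply_apply]
  · have h1 := hθ.reproduces x (e X)
    rw [family_apply] at h1
    have h2 := congrFun (ζ.family_apply e (θ x (ζ.field X x))) x
    exact h2.symm.trans h1

/-- By transitivity `θ x` is a right inverse of `ζ.evalAt x`; the source of a split surjection is
the sum of its kernel and the image of the splitting. -/
lemma IsPrincipalConnectionForm.isCompl (hζ : ζ.IsTransitive) (hθ : ζ.IsPrincipalConnectionForm θ)
    (x : M) : IsCompl (ζ.isotropyAlgebra x) (LinearMap.range (θ x)) := by
  have h : ∀ v, ζ.evalAt x (θ x v) = v := fun v => by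
    obtain ⟨X, rfl⟩ := hζ x v
    exact LinearMap.congr_fun (hθ.reproduces x) X
  constructor
  · rw [Submodule.disjoint_def]
    rintro _ h0 ⟨v, rfl⟩
    rw [← h v, show ζ.evalAt x (θ x v) = 0 from h0, map_zero]
  · rw [codisjoint_iff, Submodule.eq_top_iff']
    intro X
    rw [← sub_add_cancel X (θ x (ζ.evalAt x X))]
    refine Submodule.add_mem_sup ?_ ⟨_, rfl⟩
    show ζ.evalAt x (X - θ x (ζ.evalAt x X)) = 0
    rw [map_sub, h, sub_self]

variable [T2Space M] [PreconnectedSpace M]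

/-- Invariance is known for the automorphism built from a list of flows. Effectiveness identifies
every automorphism `A = Ad(γ)` with that one. -/
lemma IsPrincipalConnectionForm.isIsotropyInvariant (e : 𝔤 ≃ₗ[ℝ] (Fin n → ℝ))
    (hζ : ζ.IsTransitive) (heff : ζ.IsEffective) (hθ : ζ.IsPrincipalConnectionForm θ) (x : M) :
    ζ.IsIsotropyInvariant x (LinearMap.range (θ x)) := by
  rintro γ hγ A hA _ ⟨v, rfl⟩
  obtain ⟨B, L, hB, hBL, hL⟩ := exists_isAdjoint e hζ hγ
  obtain rfl := IsAdjoint.unique e hζ heff hA hB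
  obtain ⟨w, hw⟩ := (hθ.isConnectionForm e).range_invariant (hζ.isTransitiveFamily e) hL
    (Y := e (θ x v)) ⟨v, rfl⟩
  rw [← hBL] at hw
  exact ⟨w, e.injective hw⟩

lemma IsPrincipalConnectionForm.eq_of_range_eq (e : 𝔤 ≃ₗ[ℝ] (Fin n → ℝ)) (hζ : ζ.IsTransitive)
    (hθ : ζ.IsPrincipalConnectionForm θ) {θ' : ∀ x : M, TangentSpace 𝓘(ℝ, E) x →ₗ[ℝ] 𝔤}
    (hθ' : ζ.IsPrincipalConnectionForm θ') {x : M}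
    (h : LinearMap.range (θ x) = LinearMap.range (θ' x)) : θ = θ' := by
  have h1 := (hθ.isConnectionForm e).eq_of_range_eq (hζ.isTransitiveFamily e)
    (hθ'.isConnectionForm e) (x := x) (by rw [LinearMap.range_comp, LinearMap.range_comp, h])
  funext y
  ext v
  exact e.injective (LinearMap.congr_fun (congrFun h1 y) v)

/-- The projection onto `𝔪` along the isotropy algebra commutes with the adjoint action of every
transport loop at `x`: `𝔪` is preserved by hypothesis, and the isotropy algebra because such loops
fix `x`. The projection therefore spreads to a connection form. -/
lemma exists_isPrincipalConnectionForm (e : 𝔤 ≃ₗ[ℝ] (Fin n → ℝ)) (hζ : ζ.IsTransitive) {x : M}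
    {𝔪 : Submodule ℝ 𝔤} (hc : IsCompl (ζ.isotropyAlgebra x) 𝔪) (h𝔪 : ζ.IsIsotropyInvariant x 𝔪) :
    ∃ θ : ∀ y : M, TangentSpace 𝓘(ℝ, E) y →ₗ[ℝ] 𝔤,
      ζ.IsPrincipalConnectionForm θ ∧ LinearMap.range (θ x) = 𝔪 := by
  let p : 𝔤 →ₗ[ℝ] 𝔤 := 𝔪.projection (ζ.isotropyAlgebra x) hc.symm
  let P : (Fin n → ℝ) →L[ℝ] (Fin n → ℝ) := LinearMap.toContinuousLinearMap (e.conj p)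
  have hpm : ∀ X, p X ∈ 𝔪 := Submodule.projection_apply_mem hc.symm
  have hpk : ∀ X, ζ.field (X - p X) x = 0 := Submodule.sub_projection_mem hc.symm
  have hPe : ∀ Y, P Y = e (p (e.symm Y)) := fun Y => rfl
  have h1 : ∀ Y, ζ.family e (P Y) x = ζ.family e Y x := fun Y => by
    rw [hPe, family_apply]
    have h2 := hpk (e.symm Y)
    rw [map_sub, Pi.sub_apply] at h2
    exact (sub_eq_zero.1 (show (ζ.field (e.symm Y) x : E) - ζ.field (p (e.symm Y)) x = 0
      from h2)).symm
  have h0 : ∀ Y, ζ.family e Y x = 0 → P Y = 0 := fun Y hY => by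
    rw [hPe, show p (e.symm Y) = 0 from (Submodule.projection_apply_eq_zero_iff hc.symm).2 hY,
      map_zero]
  have hcomm : ∀ B B', Transport (transportedBracket e) (ζ.family e) x x B B' →
      P * B = B * P := fun B B' hB => by
    obtain ⟨γ, hγ, A, hA, hAB⟩ := exists_isAdjoint_of_transport e hζ hB
    refine ContinuousLinearMap.ext fun Y => ?_
    obtain ⟨X, rfl⟩ := e.surjective Y
    rw [mul_apply_clm, mul_apply_clm, ← hAB, hPe, hPe, e.symm_apply_apply, e.symm_apply_apply,
      ← hAB]
    congr 1
    have h2 : p (A (p X)) = A (p X) :=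
      Submodule.projection_apply_of_mem_left hc.symm (h𝔪 γ hγ A hA _ (hpm X))
    have h3 : p (A (X - p X)) = 0 := by
      refine (Submodule.projection_apply_eq_zero_iff hc.symm).2 ?_
      show ζ.field (A (X - p X)) x = 0
      have h4 : ζ.family e (e (X - p X)) x = ζ.family e (0 : Fin n → ℝ) x := by
        rw [family_apply, hpk, map_zero]
        rfl
      have h5 := hB.family_congr h4
      rw [← hAB, family_apply, map_zero, map_zero] at h5
      exact h5
    rw [map_sub, map_sub, h2] at h3
    exact sub_eq_zero.1 h3
  obtain ⟨θ, hθ, hθx⟩ := exists_connectionForm (hζ.isTransitiveFamily e) h1 h0 hcomm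
  have hee : (fun y => e.toLinearMap ∘ₗ e.symm.toLinearMap ∘ₗ θ y) = θ :=
    funext fun y => LinearMap.ext fun v => e.apply_symm_apply _
  refine ⟨fun y => e.symm.toLinearMap ∘ₗ θ y, ?_, le_antisymm ?_ fun X hX => ?_⟩
  · exact isPrincipalConnectionForm_of_isConnectionForm e (by rw [hee]; exact hθ)
  · rintro _ ⟨v, rfl⟩
    obtain ⟨Y, rfl⟩ := (hζ.isTransitiveFamily e).surjective x v
    show e.symm (θ x (ζ.family e Y x)) ∈ 𝔪
    rw [hθx, hPe, e.symm_apply_apply]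
    exact hpm _
  · refine ⟨ζ.family e (e X) x, ?_⟩
    show e.symm (θ x (ζ.family e (e X) x)) = X
    rw [hθx, hPe, e.symm_apply_apply, e.symm_apply_apply]
    exact Submodule.projection_apply_of_mem_left hc.symm hX

end LieAlgAction

end PrincipalConnectionForms

/-! ### Principal connections. -/

section PrincipalConnections

variable {𝔤 : Type*} [LieRing 𝔤] [LieAlgebra ℝ 𝔤]
  {E : Type*} [NormedAddCommGroup E] [NormedSpace ℝ E]
  {M : Type*} [TopologicalSpace M] [ChartedSpace E M] [IsManifold 𝓘(ℝ, E) ∞ M]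

/-- For a transitive action, the identity is the only principal connection. -/
lemma LieAlgAction.IsTransitive.isPrincipalConnection_iff {ζ : LieAlgAction 𝔤 E M}
    (hζ : ζ.IsTransitive)
    (Φ : ∀ x : M, TangentSpace 𝓘(ℝ, E) x →ₗ[ℝ] TangentSpace 𝓘(ℝ, E) x) :
    ζ.IsPrincipalConnection Φ ↔ Φ = fun _ => LinearMap.id := by
  have hv : ∀ x (v : TangentSpace 𝓘(ℝ, E) x), v ∈ ζ.vertical x := fun x v => hζ x v
  constructor
  · intro h
    funext x
    exact LinearMap.ext fun v => (h.isProj x).map_id v (hv x v)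
  · rintro rfl
    refine ⟨contMDiff_id, fun x => ⟨fun v => hv x _, fun v _ => rfl⟩, fun X η _ x => ?_⟩
    exact sub_self (VectorField.mlieBracket 𝓘(ℝ, E) (ζ.field X) η x : E)

end PrincipalConnections

end

theorem proposition5p7
    {𝔤 : Type*} [LieRing 𝔤] [LieAlgebra ℝ 𝔤] [FiniteDimensional ℝ 𝔤]
    {E : Type*} [NormedAddCommGroup E] [NormedSpace ℝ E] [FiniteDimensional ℝ E]
    {M : Type*} [TopologicalSpace M] [T2Space M] [ChartedSpace E M] [IsManifold 𝓘(ℝ, E) ∞ M]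
    (ζ : LieAlgAction 𝔤 E M) (hζ : ζ.IsHomogeneous) :
    -- the identity is the unique principal connection
    (∀ Φ : (∀ x : M, TangentSpace 𝓘(ℝ, E) x →ₗ[ℝ] TangentSpace 𝓘(ℝ, E) x),
      ζ.IsPrincipalConnection Φ ↔ Φ = fun _ => LinearMap.id) ∧
    (ζ.IsEffective → ∀ x : M,
      -- the representation `Ad` of the isotropy group at `x` is well defined
      (∀ γ ∈ ζ.isotropyGroup x, ∃! A : 𝔤 ≃ₗ⁅ℝ⁆ 𝔤, ζ.IsAdjoint x γ A) ∧
      -- `θ ↦ θ_x(T_x M)` is the bijection between connection forms and reductive decompositions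
      Set.BijOn (fun θ : (∀ y : M, TangentSpace 𝓘(ℝ, E) y →ₗ[ℝ] 𝔤) => LinearMap.range (θ x))
        {θ | ζ.IsPrincipalConnectionForm θ}
        {𝔪 | IsCompl (ζ.isotropyAlgebra x) 𝔪 ∧ ζ.IsIsotropyInvariant x 𝔪}) := by
  obtain ⟨hconn, htrans⟩ := hζ
  -- `𝔤` carries no norm; linear coordinates supply the normed space in which the flows and
  -- exponentials are formed.
  have e : 𝔤 ≃ₗ[ℝ] (Fin (Module.finrank ℝ 𝔤) → ℝ) := (Module.finBasis ℝ 𝔤).equivFun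
  refine ⟨htrans.isPrincipalConnection_iff, fun heff x => ⟨fun γ hγ => ?_, ?_, ?_, ?_⟩⟩
  · obtain ⟨A, -, hA, -, -⟩ := LieAlgAction.exists_isAdjoint e htrans hγ
    exact ⟨A, hA, fun B hB => LieAlgAction.IsAdjoint.unique e htrans heff hB hA⟩
  · exact fun θ hθ => ⟨hθ.isCompl htrans x, hθ.isIsotropyInvariant e htrans heff x⟩
  · exact fun θ hθ θ' hθ' h => hθ.eq_of_range_eq e htrans hθ' h
  · rintro 𝔪 ⟨hc, h𝔪⟩
    exact LieAlgAction.exists_isPrincipalConnectionForm e htrans hc h𝔪
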